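/- Let $R$ be a Noetherian local ring with maximal ideal $\mathfrak m$ and infinite perfect residue field $k=R/\mathfrak m$. For an ideal $J$ of $R$ let $\mathcal F(J)=\mathrm{gr}_J(R)\otimes_R k$ denote its special fiber ring. Let $I$ be a proper ideal of $R$ of analytic spread $\ell=\dim\mathcal F(I)$, assume $\ell\ge 1$, and let $s$ be a positive integer. Let $f_1,\dots,f_{\ell+s}$ be general elements of $I$, put $\mathfrak a=(f_1,\dots,f_{\ell-1})$ and $K=(f_1,\dots,f_{\ell+s})$, and let $\varphi\colon\mathcal F(K)\to\mathcal F(I)$ be the natural map. (That $f_1,\dots,f_{\ell+s}$ are general means that the assertion holds for all tuples whose image in $(I\otimes_R k)^{\ell+s}$ lies in a suitable nonempty Zariski open subset, depending only on $R$, $I$ and $s$.) Then the following are equivalent: (i) $I^n=(f_1,\dots,f_{\ell-1})\,I^{n-1}+(f_\ell,\dots,f_{\ell+s})^n$ for all $n\gg 0$; (ii) $\operatorname{coker}(\varphi)$ is a finitely generated $\mathcal F(\mathfrak a)$-module, via the natural map $\mathcal F(\mathfrak a)\to\mathcal F(K)$; (iii) for every minimal prime $\mathfrak q$ of $\mathcal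 F(I)$ with $\dim\mathcal F(I)/\mathfrak q=\ell$, the local ring $\mathcal F(I)_{\mathfrak q}$ has embedding dimension at most $s$. -/

import Mathlib

open IsLocalRing
open scoped TensorProduct

namespace SpecialFiber

theorem reesAlgebra_le {R : Type*} [CommRing R] {J I : Ideal R} (h : J ≤ I) :
    reesAlgebra J ≤ reesAlgebra I :=
  fun _ hf i => Ideal.pow_right_mono h i (hf i)

section Fiber

variable {R : Type*} [CommRing R] [IsLocalRing R]

/-- The ideal `(I + 𝔪) R[It]` of the Rees algebra `R[It]`. -/
noncomputable def fiberIdeal (I : Ideal R) : Ideal (reesAlgebra I) :=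
  (I ⊔ maximalIdeal R).map (algebraMap R (reesAlgebra I))

/-- The special fiber ring `𝓕(I) = gr_I(R) ⊗ k`.  Since `gr_I(R) = R[It] / I R[It]`, tensoring
with `k = R / 𝔪` gives `R[It] / (I + 𝔪) R[It]`.  For proper `I` this is `R[It] / 𝔪 R[It]`, and
it is the zero ring for `I = R`. -/
def FiberRing (I : Ideal R) : Type _ := reesAlgebra I ⧸ fiberIdeal I

noncomputable instance (I : Ideal R) : CommRing (FiberRing I) :=
  Ideal.Quotient.commRing (fiberIdeal I)

/-- The analytic spread `ℓ(I) = dim 𝓕(I)`. -/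
noncomputable def analyticSpread (I : Ideal R) : WithBot ℕ∞ := ringKrullDim (FiberRing I)

theorem fiberIdeal_le_comap {J I : Ideal R} (h : J ≤ I) :
    fiberIdeal J ≤
      (fiberIdeal I).comap (Subalgebra.inclusion (reesAlgebra_le h) :
        reesAlgebra J →+* reesAlgebra I) := by
  rw [fiberIdeal, Ideal.map_le_iff_le_comap]
  intro r hr
  exact Ideal.mem_map_of_mem (algebraMap R (reesAlgebra I)) (sup_le_sup_right h _ hr)

/-- The natural map `𝓕(J) → 𝓕(I)` for `J ⊆ I`, induced by the inclusion `R[Jt] ⊆ R[It]`. -/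
noncomputable def fiberMap {J I : Ideal R} (h : J ≤ I) : FiberRing J →+* FiberRing I :=
  Ideal.quotientMap (fiberIdeal I)
    (Subalgebra.inclusion (reesAlgebra_le h) : reesAlgebra J →+* reesAlgebra I)
    (fiberIdeal_le_comap h)

/-- For ring maps `α : A → B` and `φ : B → C`, the cokernel `C / φ(B)` of `φ`, which is a
`B`-module, is finitely generated as an `A`-module by restriction of scalars along `α`. -/
def CokerFinite {A B C : Type*} [CommRing A] [CommRing B] [CommRing C]
    (α : A →+* B) (φ : B →+* C) : Prop :=
  letI : Algebra B C := φ.toAlgebra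
  letI : Module A (C ⧸ LinearMap.range (Algebra.linearMap B C)) := Module.compHom _ α
  Module.Finite A (C ⧸ LinearMap.range (Algebra.linearMap B C))

/-- The embedding dimension of a (Noetherian) local ring. -/
noncomputable def embDim (A : Type*) [CommRing A] [IsLocalRing A] : ℕ :=
  Module.finrank (ResidueField A) (CotangentSpace A)

/-- `B` has embedding dimension at most `s` locally at every minimal prime `q` of dimension `d`,
that is, with `dim B / q = d`. -/
def EmbDimLEAtMinimalPrimes (B : Type*) [CommRing B] (d s : ℕ) : Prop :=
  ∀ (q : Ideal B) [q.IsPrime], q ∈ minimalPrimes B → ringKrullDim (B ⧸ q) = d →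
    embDim (Localization.AtPrime q) ≤ s

/-- Zariski open subsets of (the `k`-points of) a vector space `W`: unions of nonvanishing loci
of polynomial functions, where a polynomial function is a polynomial in linear forms. -/
def IsZariskiOpen (k : Type*) {W : Type*} [Field k] [AddCommGroup W] [Module k W]
    (U : Set W) : Prop :=
  ∃ S : Set (MvPolynomial (Module.Dual k W) k),
    U = {w | ∃ p ∈ S, MvPolynomial.eval (fun φ : Module.Dual k W => φ w) p ≠ 0}

/-- The image in `(I ⊗ k)^t` of a `t`-tuple of elements of `I`. -/
noncomputable def tupleImage {I : Ideal R} {t : ℕ} (f : Fin t → I) : Fin t → ResidueField R ⊗[R] I :=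
  fun i => 1 ⊗ₜ[R] f i

/-- `P` holds for `t` general elements `f₁, …, f_t` of `I`: it holds for all tuples whose image
in `(I ⊗ k)^t` lies in some fixed nonempty Zariski open subset. -/
def ForGeneral (I : Ideal R) (t : ℕ) (P : (Fin t → I) → Prop) : Prop :=
  ∃ U : Set (Fin t → ResidueField R ⊗[R] I),
    IsZariskiOpen (ResidueField R) U ∧ U.Nonempty ∧ ∀ f : Fin t → I, tupleImage f ∈ U → P f

end Fiber

section Tuples

variable {R : Type*} [CommRing R] {I : Ideal R} {t : ℕ}

/-- The ideal `(f₁, …, f_{ℓ-1})`; the element `f_j` is `f i` with `j = i + 1`. -/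
def headIdeal (l : ℕ) (f : Fin t → I) : Ideal R :=
  Ideal.span {x | ∃ i : Fin t, (i : ℕ) + 1 < l ∧ x = f i}

/-- The ideal `(f_ℓ, …, f_t)`; the element `f_j` is `f i` with `j = i + 1`. -/
def tailIdeal (l : ℕ) (f : Fin t → I) : Ideal R :=
  Ideal.span {x | ∃ i : Fin t, l ≤ (i : ℕ) + 1 ∧ x = f i}

/-- The ideal `(f₁, …, f_t)`. -/
def fullIdeal (f : Fin t → I) : Ideal R :=
  Ideal.span {x | ∃ i : Fin t, x = f i}

theorem headIdeal_le (l : ℕ) (f : Fin t → I) : headIdeal l f ≤ fullIdeal f :=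
  Ideal.span_mono fun _ ⟨i, _, h⟩ => ⟨i, h⟩

theorem fullIdeal_le (f : Fin t → I) : fullIdeal f ≤ I :=
  Ideal.span_le.2 fun _ ⟨i, h⟩ => h ▸ (f i).2

end Tuples

end SpecialFiber

/-!
Let `A` be the special fiber ring of `I`, a standard graded algebra over the residue field `k` whose
linear forms are a quotient of `I ⊗ k`, and let `v_1, …, v_{l+s}` be linear forms in `A`. Put
`B = k[v_1, …, v_{l+s}]` and `C = k[v_1, …, v_{l-1}]`. The theorem rests on the property
`QuotientFinite C B`, that `A / B` is a finitely generated `C`-module.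

*The first two conditions.* The equation between ideals in one degree `n ≥ 1` gives the equation
`A_n = (v_1, …, v_{l-1}) A_{n-1} + (v_l, …, v_{l+s})^n` (`isReductionAt_of_pow_eq`). This propagates
to all larger degrees and makes `A / B` finite over `C` (`quotientFinite_of_pow_le`). That in turn
gives the finiteness of the cokernel (`HasFiniteQuotient.cokerFinite`), and, comparing coefficients
in large degrees and applying Nakayama's lemma, the cokernel condition gives back the equations
between ideals (`eventually_pow_eq_of_cokerFinite`). The equation in `A_n` is an open condition on
the `v_i`, as it says that certain vectors depending polynomially on the `v_i` span a fixed space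
(`isZariskiOpen_isReductionAt`). So it remains to prove that some tuple has the property
`QuotientFinite C B` if and only if the embedding dimensions are at most `s`: if the open set is
nonempty, it serves as the set of general tuples, and otherwise all three conditions always fail.

*From finiteness to embedding dimension* (`embDim_le_of_quotientFinite`). Let `q` be a minimal prime
with `dim A / q = l`. If `q` contained the conductor of `A` in `B`, then by the Cayley-Hamilton
theorem `A / q` would be integral over `C`, which has dimension at most `l - 1`. So `A_q` is a
quotient of a localization of `k[T_1, …, T_{l+s}]` at a prime of dimension `l`, and that is a regular
local ring of dimension at most `s`.

*From embedding dimension to finiteness* (`exists_quotientFinite_of_embDim_le`). As `k` is perfect,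
the space of derivations from `A` to the residue field at `q` has dimension at most `l + s`
(`finrank_derivation_residueField_le`), while `dim A = l < l + s`. So a generic linear projection to
`l + s` coordinates is finite, separates the generic points `q` from all other points, and separates
tangent vectors at them (`exists_submodule_separates`); it is obtained by successive projections
from a point off a secant cone and off a tangent space. Then the fiber through `q` is a single
reduced point (`eq_of_separates`), so the projection is an isomorphism near `q`, and the conductor
of `A` in `B` is contained in no such `q`. Therefore `B` modulo the conductor has dimension at most
`l - 1`, and by linear Noether normalization it is finite over the algebra generated by `l - 1`
linear forms. Such a family, completed to one that generates `B`, has the required property.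
-/

namespace SpecialFiber

/-! ### Krull dimension in integral extensions -/

section Dimension

theorem ringKrullDim_le_of_isIntegral (A B : Type*) [CommRing A] [CommRing B] [Algebra A B]
    [Algebra.IsIntegral A B] : ringKrullDim B ≤ ringKrullDim A := by
  refine Order.krullDim_le_of_strictMono (PrimeSpectrum.comap (algebraMap A B)) fun p q h => ?_
  obtain ⟨x, hxq, hxp⟩ := SetLike.exists_of_lt (show p.asIdeal < q.asIdeal from h)
  exact Ideal.comap_lt_comap_of_integral_mem_sdiff (le_of_lt h) ⟨hxq, hxp⟩
    (Algebra.IsIntegral.isIntegral x)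

theorem ringKrullDim_le_of_isIntegral_of_injective (A B : Type*) [CommRing A] [CommRing B]
    [Algebra A B] [Algebra.IsIntegral A B] (h : Function.Injective (algebraMap A B)) :
    ringKrullDim A ≤ ringKrullDim B := by
  -- Lying over for the smallest prime of a chain, then going up along the chain.
  refine iSup_le fun l => ?_
  have : FaithfulSMul A B := (faithfulSMul_iff_algebraMap_injective A B).2 h
  obtain ⟨⟨P, hP, hP'⟩⟩ := Ideal.nonempty_primesOver (S := B) l.head.asIdeal
  obtain ⟨L, hL, -⟩ := Ideal.exists_ltSeries_of_hasGoingUp l P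
  rw [← hL]
  exact le_iSup (fun p : LTSeries (PrimeSpectrum B) => (p.length : WithBot ℕ∞)) L

theorem ringKrullDim_eq_of_isIntegral_of_injective (A B : Type*) [CommRing A] [CommRing B]
    [Algebra A B] [Algebra.IsIntegral A B] (h : Function.Injective (algebraMap A B)) :
    ringKrullDim A = ringKrullDim B :=
  (ringKrullDim_le_of_isIntegral_of_injective A B h).antisymm (ringKrullDim_le_of_isIntegral A B)

/-- In an integral extension, the quotient by a prime has the same dimension as the quotient by
its contraction. -/
theorem ringKrullDim_quotient_comap {A B : Type*} [CommRing A] [CommRing B]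
    [Algebra A B] [Algebra.IsIntegral A B] (q : Ideal B) :
    ringKrullDim (A ⧸ q.comap (algebraMap A B)) = ringKrullDim (B ⧸ q) :=
  ringKrullDim_eq_of_isIntegral_of_injective _ _
    (Ideal.algebraMap_quotient_injective (R := A) (I := q))

theorem height_add_ringKrullDim_quotient_le {A : Type*} [CommRing A] (q : Ideal A)
    [hq : q.IsPrime] :
    (q.height : WithBot ℕ∞) + ringKrullDim (A ⧸ q) ≤ ringKrullDim A := by
  have : Nonempty (PrimeSpectrum A) := ⟨⟨q, hq⟩⟩
  have h1 := PrimeSpectrum.height_eq_orderHeight (⟨q, hq⟩ : PrimeSpectrum A)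
  have h2 : ringKrullDim (A ⧸ q) =
      (Order.coheight (⟨q, hq⟩ : PrimeSpectrum A) : WithBot ℕ∞) := by
    rw [ringKrullDim_quotient, Order.coheight_eq_krullDim_Ici]
    rfl
  rw [h2, show q.height = _ from h1, ringKrullDim,
    Order.krullDim_eq_iSup_height_add_coheight_of_nonempty, ← WithBot.coe_add]
  exact WithBot.coe_le_coe.2 (le_iSup (fun p : PrimeSpectrum A => Order.height p +
    Order.coheight p) _)

theorem mem_minimalPrimes_of_ringKrullDim_quotient_eq {A : Type*} [CommRing A] {n : ℕ}
    (hA : ringKrullDim A = n) (q : Ideal A) [q.IsPrime] (hq : ringKrullDim (A ⧸ q) = n) :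
    q ∈ minimalPrimes A := by
  have h := height_add_ringKrullDim_quotient_le q
  rw [hA, hq] at h
  rw [← Ideal.height_eq_zero_iff]
  have h' : q.height + (n : ℕ∞) ≤ n := by exact_mod_cast h
  generalize q.height = a at h'
  cases a with
  | top => simp at h'
  | coe a =>
    have : a + n ≤ n := by exact_mod_cast h'
    have : a = 0 := by omega
    simp [this]

theorem ringKrullDim_mvPolynomial_field (k : Type*) [Field k] (n : ℕ) :
    ringKrullDim (MvPolynomial (Fin n) k) = n := by
  rw [MvPolynomial.ringKrullDim_of_isNoetherianRing, ringKrullDim_eq_zero_of_field]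
  simp

/-- Noether normalization, with the number of variables equal to the Krull dimension. -/
theorem exists_integral_injective_algHom_of_ringKrullDim (k D : Type*) [Field k] [CommRing D]
    [Nontrivial D] [Algebra k D] [Algebra.FiniteType k D] :
    ∃ (r : ℕ) (g : MvPolynomial (Fin r) k →ₐ[k] D), ringKrullDim D = r ∧
      Function.Injective g ∧ g.IsIntegral := by
  obtain ⟨r, g, hg, hi⟩ := exists_integral_inj_algHom_of_fg k D
  refine ⟨r, g, ?_, hg, hi⟩
  algebraize [g.toRingHom]
  rw [← ringKrullDim_mvPolynomial_field k r]
  have : Algebra.IsIntegral (MvPolynomial (Fin r) k) D := ⟨hi⟩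
  exact (ringKrullDim_eq_of_isIntegral_of_injective _ _ hg).symm

theorem isAlgebraic_adjoin_of_isIntegral {k D : Type*} [Field k] [CommRing D] [Nontrivial D]
    [Algebra k D] {r : ℕ} (g : MvPolynomial (Fin r) k →ₐ[k] D) (hg : g.IsIntegral) :
    Algebra.IsAlgebraic (Algebra.adjoin k (Set.range fun i => g (MvPolynomial.X i))) D := by
  refine ⟨fun x => IsIntegral.isAlgebraic ?_⟩
  have hr : g.range = Algebra.adjoin k (Set.range fun i => g (MvPolynomial.X i)) := by
    rw [← Algebra.map_top, ← MvPolynomial.adjoin_range_X, AlgHom.map_adjoin, ← Set.range_comp]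
    rfl
  rw [← hr]
  obtain ⟨p, hp, hx⟩ := hg x
  refine ⟨p.map g.rangeRestrict.toRingHom, hp.map _, ?_⟩
  rw [Polynomial.eval₂_map]
  exact hx

theorem mk_range_fin_le {α : Type*} {n : ℕ} (f : Fin n → α) :
    Cardinal.mk (Set.range f) ≤ n := by
  have := Cardinal.mk_range_le_lift (f := f)
  simpa using this

/-- Algebraically independent elements of a finitely generated algebra, possibly with zero
divisors, number at most its Krull dimension. -/
theorem _root_.AlgebraicIndependent.card_le_ringKrullDim {k D : Type*} [Field k] [CommRing D]
    [Algebra k D] [Algebra.FiniteType k D] {M : ℕ} {x : Fin M → D}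
    (hx : AlgebraicIndependent k x) : (M : WithBot ℕ∞) ≤ ringKrullDim D := by
  have : Nontrivial D := by
    rw [AlgebraicIndependent] at hx
    exact hx.nontrivial
  -- Some minimal prime contracts to zero, so the elements stay independent in a quotient domain.
  obtain ⟨P, hP, hPx⟩ := Ideal.exists_minimalPrimes_comap_eq (I := (⊥ : Ideal D))
    (MvPolynomial.aeval (R := k) x).toRingHom ⊥ (by
      have : Ideal.comap (MvPolynomial.aeval (R := k) x).toRingHom ⊥ = ⊥ :=
        (RingHom.injective_iff_ker_eq_bot _).1 hx
      rw [this, Ideal.minimalPrimes_eq_subsingleton_self]; rfl)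
  have := hP.isPrime
  obtain ⟨r, g, hr, -, hi⟩ := exists_integral_injective_algHom_of_ringKrullDim k D
  have hi' : ((Ideal.Quotient.mkₐ k P).comp g).IsIntegral :=
    hi.trans _ _ (RingHom.isIntegral_of_surjective _ Ideal.Quotient.mk_surjective)
  have h1 := isAlgebraic_adjoin_of_isIntegral _ hi'
  have h2 := Algebra.IsAlgebraic.trdeg_le_cardinalMk k
    (Set.range fun i => ((Ideal.Quotient.mkₐ k P).comp g) (MvPolynomial.X i))
  have h3 : AlgebraicIndependent k (Ideal.Quotient.mkₐ k P ∘ x) := by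
    have hc : MvPolynomial.aeval (Ideal.Quotient.mkₐ k P ∘ x) =
        (Ideal.Quotient.mkₐ k P).comp (MvPolynomial.aeval (R := k) x) := by ext; simp
    rw [AlgebraicIndependent, hc, injective_iff_map_eq_zero]
    intro p hp
    have hp' : p ∈ Ideal.comap (MvPolynomial.aeval (R := k) x).toRingHom P :=
      (Ideal.Quotient.eq_zero_iff_mem.1 hp : MvPolynomial.aeval x p ∈ P)
    rwa [hPx] at hp'
  have h4 := h3.lift_cardinalMk_le_trdeg
  have h5 := h4.trans (Cardinal.lift_le.2 (h2.trans (mk_range_fin_le _)))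
  rw [hr]
  simp only [Cardinal.mk_fin, Cardinal.lift_natCast, Nat.cast_le] at h5
  exact_mod_cast h5

theorem trdeg_residueField {k A : Type*} [Field k] [CommRing A] [Algebra k A]
    [Algebra.FiniteType k A] (q : Ideal A) [q.IsPrime] {n : ℕ} (h : ringKrullDim (A ⧸ q) = n) :
    Algebra.trdeg k q.ResidueField = n := by
  obtain ⟨r, g, hr, hg, hi⟩ := exists_integral_injective_algHom_of_ringKrullDim k (A ⧸ q)
  obtain rfl : n = r := by rw [hr] at h; exact_mod_cast h.symm
  have h1 := isAlgebraic_adjoin_of_isIntegral _ hi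
  have h2 : AlgebraicIndependent k fun i => g (MvPolynomial.X i) := by
    have : MvPolynomial.aeval (fun i => g (MvPolynomial.X i)) = g := by ext; simp
    rw [AlgebraicIndependent, this]
    exact hg
  have h3 : Algebra.trdeg k (A ⧸ q) = n := by
    apply le_antisymm
    · exact (Algebra.IsAlgebraic.trdeg_le_cardinalMk k
        (Set.range fun i => g (MvPolynomial.X i))).trans (mk_range_fin_le _)
    · have := h2.lift_cardinalMk_le_trdeg
      simpa using this
  rw [← h3, ← trdeg_add_eq k (A ⧸ q) (A := q.ResidueField), trdeg_eq_zero (R := A ⧸ q), add_zero]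

end Dimension

/-! ### Derivations into residue fields -/

section Derivations

/-- A derivation of a field extension that vanishes on a separating set of generators is zero. -/
theorem derivation_eq_zero_of_isSeparable {k K : Type*} [Field k] [Field K] [Algebra k K]
    (s : Set K) [Algebra.IsSeparable (IntermediateField.adjoin k s) K]
    (D : Derivation k K K) (hD : ∀ x ∈ s, D x = 0) : D = 0 := by
  let C : IntermediateField k K :=
    { carrier := {x | D x = 0}
      mul_mem' := fun {a b} ha hb => by
        simp only [Set.mem_ofPred_eq] at ha hb ⊢
        simp [ha, hb]
      add_mem' := fun {a b} ha hb => by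
        simp only [Set.mem_ofPred_eq] at ha hb ⊢
        simp [ha, hb]
      algebraMap_mem' := fun r => D.map_algebraMap r
      inv_mem' := fun a ha => by
        simp only [Set.mem_ofPred_eq] at ha ⊢
        simp [Derivation.leibniz_inv, ha] }
  have hC : IntermediateField.adjoin k s ≤ C := IntermediateField.adjoin_le_iff.2 hD
  let D' : Derivation (IntermediateField.adjoin k s) K K :=
    Derivation.mk'
      { toFun := D
        map_add' := D.map_add
        map_smul' := fun c x => by
          have hc : D (c : K) = 0 := hC c.2
          rw [Algebra.smul_def, D.leibniz]
          simp [hc, Algebra.smul_def] }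
      (fun a b => D.leibniz a b)
  have : Algebra.FormallyUnramified (IntermediateField.adjoin k s) K :=
    .of_isSeparable _ _
  have h0 : D' = 0 := by
    rw [← D'.liftKaehlerDifferential_comp, Subsingleton.elim D'.liftKaehlerDifferential 0]
    rfl
  ext x
  exact congrArg (fun E : Derivation (IntermediateField.adjoin k s) K K => E x) h0

/-- Derivations into a module over the localization extend to the localization. -/
theorem exists_derivation_localization {k A O M : Type*} [CommRing k] [CommRing A] [CommRing O]
    [Algebra k A] [Algebra k O] [Algebra A O] [IsScalarTower k A O] (S : Submonoid A)
    [IsLocalization S O] [AddCommGroup M] [Module k M] [Module A M] [Module O M]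
    [IsScalarTower k A M] [IsScalarTower A O M] [IsScalarTower k O M] (D : Derivation k A M) :
    ∃ D' : Derivation k O M, ∀ a, D' (algebraMap A O a) = D a := by
  let f := KaehlerDifferential.map k k A O
  have hf : IsLocalizedModule S f := KaehlerDifferential.isLocalizedModule_map _ _ _ S
  have hu : ∀ x : S, IsUnit ((algebraMap A (Module.End A M)) x) := by
    intro x
    have := IsLocalization.map_units O x
    have h2 := this.map (algebraMap O (Module.End O M))
    rw [Module.End.isUnit_iff] at h2 ⊢
    convert h2 using 1
    ext m
    simp
  let g : Ω[O⁄k] →ₗ[A] M := IsLocalizedModule.lift S f D.liftKaehlerDifferential hu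
  let g' : Ω[O⁄k] →ₗ[O] M := g.extendScalarsOfIsLocalization S O
  refine ⟨g'.compDer (KaehlerDifferential.D k O), fun a => ?_⟩
  have := IsLocalizedModule.lift_apply S f D.liftKaehlerDifferential hu
    (KaehlerDifferential.D k A a)
  simpa [f, g, g'] using this

/-- The space of derivations of `A` into the residue field at `q` has dimension at most the
embedding dimension of `A_q` plus the transcendence degree of the residue field. -/
theorem finrank_derivation_residueField_le {k A : Type*} [Field k] [PerfectField k] [CommRing A]
    [Algebra k A] [Algebra.FiniteType k A] (q : Ideal A) [q.IsPrime] {n : ℕ}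
    (hn : Algebra.trdeg k q.ResidueField = n) :
    Module.Finite q.ResidueField (Derivation k A q.ResidueField) ∧
    Module.finrank q.ResidueField (Derivation k A q.ResidueField) ≤
      embDim (Localization.AtPrime q) + n := by
  set O := Localization.AtPrime q
  set K := q.ResidueField
  have : IsNoetherianRing A := Algebra.FiniteType.isNoetherianRing k A
  have : IsNoetherianRing O := IsLocalization.isNoetherianRing q.primeCompl _ inferInstance
  have : Algebra.EssFiniteType k K := Algebra.EssFiniteType.comp k A K
  obtain ⟨s, hs, hsep⟩ := exists_isTranscendenceBasis_and_isSeparable_of_perfectField k K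
  have hcard : s.card = n := by
    have := hs.cardinalMk_eq_trdeg
    rw [hn] at this
    simpa using this
  have hfg : (maximalIdeal O).FG := IsNoetherian.noetherian _
  obtain ⟨μ, hμcard, hμ⟩ := Submodule.FG.exists_span_finset_card_eq_spanFinrank hfg
  have hemb : (maximalIdeal O).spanFinrank = embDim O :=
    spanFinrank_maximalIdeal_eq_finrank_cotangentSpace_of_fg hfg
  -- A derivation of `O` with values in `K` is determined by its values on generators of the maximal
  -- ideal and on lifts of a separating transcendence basis of `K`.
  choose t ht using residue_surjective (R := O)
  have hsmul : ∀ (x : O) (y : K), x • y = residue O x * y := fun x y => Algebra.smul_def x y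
  let Φ : Derivation k O K →ₗ[K] (μ → K) × (s → K) :=
    { toFun := fun D => (fun i => D i, fun x => D (t x))
      map_add' := fun _ _ => rfl
      map_smul' := fun _ _ => rfl }
  have hΦ : Function.Injective Φ := by
    rw [injective_iff_map_eq_zero]
    intro D hD
    have h1 : ∀ i ∈ μ, D i = 0 := fun i hi => congrFun (congrArg Prod.fst hD) ⟨i, hi⟩
    have h2 : ∀ x ∈ s, D (t x) = 0 := fun x hx => congrFun (congrArg Prod.snd hD) ⟨x, hx⟩
    have h3 : ∀ y ∈ maximalIdeal O, D y = 0 := by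
      intro y hy
      rw [← hμ] at hy
      induction hy using Submodule.span_induction with
      | mem x hx => exact h1 x hx
      | zero => exact D.map_zero
      | add x y _ _ hx hy => rw [D.map_add, hx, hy, add_zero]
      | smul a x hx h =>
        have hx' : residue O x = 0 := (residue_eq_zero_iff x).2 (hμ ▸ hx)
        rw [smul_eq_mul, D.leibniz, h, smul_zero, hsmul, hx', zero_mul, add_zero]
    have h4 : ∀ x y, residue O x = residue O y → D x = D y := by
      intro x y hxy
      rw [← sub_eq_zero, ← map_sub]
      exact h3 _ ((residue_eq_zero_iff _).1 (by rw [map_sub, hxy, sub_self]))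
    let D' : Derivation k K K := Derivation.mk'
      { toFun := fun x => D (t x)
        map_add' := fun x y => by
          rw [← D.map_add]
          exact h4 _ _ (by simp [ht])
        map_smul' := fun c x => by
          rw [RingHom.id_apply, ← D.map_smul]
          refine h4 _ _ ?_
          rw [ht, Algebra.smul_def, Algebra.smul_def, map_mul, ht]
          rfl }
      (fun a b => by
        change D (t (a * b)) = a * D (t b) + b * D (t a)
        rw [h4 (t (a * b)) (t a * t b) (by simp [ht]), D.leibniz, hsmul, hsmul, ht, ht])
    have h5 : D' = 0 := derivation_eq_zero_of_isSeparable (s : Set K) D' h2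
    ext x
    rw [h4 x (t (residue O x)) (ht _).symm]
    exact congrArg (fun E : Derivation k K K => E (residue O x)) h5
  have : Module.Finite K (Derivation k O K) := Module.Finite.of_injective Φ hΦ
  have hle : Module.finrank K (Derivation k O K) ≤ embDim O + n := by
    refine (LinearMap.finrank_le_finrank_of_injective hΦ).trans ?_
    simp [hμcard, hemb, hcard]
  let Ψ : Derivation k O K →ₗ[K] Derivation k A K :=
    { toFun := fun D => D.compAlgebraMap A
      map_add' := fun _ _ => rfl
      map_smul' := fun _ _ => rfl }
  have hΨ : Function.Surjective Ψ := by
    intro D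
    obtain ⟨D', hD'⟩ := exists_derivation_localization (O := O) q.primeCompl D
    exact ⟨D', Derivation.ext hD'⟩
  exact ⟨Module.Finite.of_surjective Ψ hΨ,
    (LinearMap.finrank_le_finrank_of_surjective hΨ).trans hle⟩

end Derivations

/-! ### Linear projections and Noether normalization -/

section LinearProjection

/-- Finitely many nonzero polynomials over extensions of an infinite field `k` have a common
nonvanishing point with coordinates in `k`. -/
theorem exists_forall_eval_ne_zero {k : Type*} [Field k] [Infinite k] {M : ℕ}
    (F : MvPolynomial (Fin M) k) (hF : F ≠ 0) {ι : Type*} [Finite ι] (K : ι → Type*)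
    [∀ i, Field (K i)] [∀ i, Algebra k (K i)] (H : ∀ i, MvPolynomial (Fin M) (K i))
    (hH : ∀ i, H i ≠ 0) :
    ∃ c : Fin M → k, MvPolynomial.eval c F ≠ 0 ∧
      ∀ i, MvPolynomial.eval (fun j => algebraMap k (K i) (c j)) (H i) ≠ 0 := by
  have key : ∀ i, ∃ G : MvPolynomial (Fin M) k, G ≠ 0 ∧ ∀ c, MvPolynomial.eval c G ≠ 0 →
      MvPolynomial.eval (fun j => algebraMap k (K i) (c j)) (H i) ≠ 0 := by
    intro i
    -- Apply a `k`-linear functional that does not kill all the coefficients.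
    obtain ⟨e, he⟩ := MvPolynomial.ne_zero_iff.1 (hH i)
    obtain ⟨φ, hφ⟩ := Module.Projective.exists_dual_ne_zero k he
    let G : MvPolynomial (Fin M) k :=
      ∑ d ∈ (H i).support, MvPolynomial.monomial d (φ ((H i).coeff d))
    have hGe : G.coeff e = φ ((H i).coeff e) := by
      simp only [G, MvPolynomial.coeff_sum, MvPolynomial.coeff_monomial]
      rw [Finset.sum_ite_eq' (H i).support e, if_pos (MvPolynomial.mem_support_iff.2 he)]
    refine ⟨G, fun h => hφ (by rw [← hGe, h, MvPolynomial.coeff_zero]), fun c hc h => hc ?_⟩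
    have : MvPolynomial.eval c G =
        φ (MvPolynomial.eval (fun j => algebraMap k (K i) (c j)) (H i)) := by
      rw [MvPolynomial.eval_eq _ (H i), map_sum]
      simp only [map_sum, MvPolynomial.eval_monomial]
      refine Finset.sum_congr rfl fun d _ => ?_
      rw [Finsupp.prod_fintype _ _ fun _ => pow_zero _]
      have h2 : ∏ j ∈ d.support, algebraMap k (K i) (c j) ^ d j =
          algebraMap k (K i) (∏ j, c j ^ d j) := by
        rw [map_prod, ← Finset.prod_subset (Finset.subset_univ d.support)]
        · simp
        · intro j _ hj
          simp [Finsupp.notMem_support_iff.1 hj]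
      rw [h2, mul_comm (MvPolynomial.coeff d (H i)), ← Algebra.smul_def, φ.map_smul, smul_eq_mul,
        mul_comm]
    rw [this, h, map_zero]
  choose G hG0 hG using key
  have := Fintype.ofFinite ι
  have hP : F * ∏ i, G i ≠ 0 := mul_ne_zero hF (Finset.prod_ne_zero_iff.2 fun i _ => hG0 i)
  obtain ⟨c, hc⟩ : ∃ c, MvPolynomial.eval c (F * ∏ i, G i) ≠ 0 := by
    by_contra! h
    exact hP (MvPolynomial.funext fun c => by simpa using h c)
  rw [map_mul, map_prod] at hc
  exact ⟨c, left_ne_zero_of_mul hc, fun i => hG i c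
    (Finset.prod_ne_zero_iff.1 (right_ne_zero_of_mul hc) i (Finset.mem_univ i))⟩

open Polynomial in
theorem coeff_prod_linear_pow {B : Type*} [CommRing B] {M : ℕ} (β c : Fin M → B) (e : Fin M →₀ ℕ) :
    (∏ j, (C (β j) + C (c j) * X) ^ e j).natDegree ≤ e.degree ∧
      (∏ j, (C (β j) + C (c j) * X) ^ e j).coeff e.degree = ∏ j, c j ^ e j := by
  have h1 : ∀ j, (C (β j) + C (c j) * X).natDegree ≤ 1 := fun j => by
    compute_degree
  have h2 : ∀ j, ((C (β j) + C (c j) * X) ^ e j).natDegree ≤ e j := fun j => by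
    simpa using natDegree_pow_le_of_le (e j) (h1 j)
  have h3 : ∀ j, ((C (β j) + C (c j) * X) ^ e j).coeff (e j) = c j ^ e j := fun j => by
    have := coeff_pow_of_natDegree_le (m := e j) (h1 j)
    simpa using this
  have hd : e.degree = ∑ j, e j := by simp [Finsupp.degree_eq_sum]
  rw [hd]
  refine ⟨(natDegree_prod_le _ _).trans (Finset.sum_le_sum fun j _ => h2 j), ?_⟩
  suffices ∀ s : Finset (Fin M), (∏ j ∈ s, (C (β j) + C (c j) * X) ^ e j).coeff (∑ j ∈ s, e j) =
      ∏ j ∈ s, c j ^ e j from this _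
  intro s
  induction s using Finset.induction_on with
  | empty => simp
  | insert a s ha ih =>
    rw [Finset.prod_insert ha, Finset.sum_insert ha, Finset.prod_insert ha,
      coeff_mul_add_eq_of_natDegree_le (h2 a)
        ((natDegree_prod_le _ _).trans (Finset.sum_le_sum fun j _ => h2 j)), h3, ih]

open Polynomial in
/-- The leading coefficient of the restriction of a polynomial to the line `β + T c`. -/
theorem natDegree_aeval_line_le {k B : Type*} [CommRing k] [CommRing B] [Algebra k B] {M : ℕ}
    (F : MvPolynomial (Fin M) k) (β c : Fin M → B) :
    (MvPolynomial.aeval (fun j => C (β j) + C (c j) * X) F).natDegree ≤ F.totalDegree ∧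
      (MvPolynomial.aeval (fun j => C (β j) + C (c j) * X) F).coeff F.totalDegree =
        MvPolynomial.aeval c (MvPolynomial.homogeneousComponent F.totalDegree F) := by
  classical
  set g : Fin M → B[X] := fun j => C (β j) + C (c j) * X
  have hF : MvPolynomial.aeval g F =
      ∑ e ∈ F.support, C (algebraMap k B (F.coeff e)) * ∏ j, g j ^ e j := by
    rw [MvPolynomial.aeval_def, MvPolynomial.eval₂_eq']
    rfl
  have hle : ∀ e ∈ F.support, e.degree ≤ F.totalDegree := fun e he => by
    exact MvPolynomial.le_totalDegree he
  have hlin := fun e => coeff_prod_linear_pow β c e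
  have hdeg : ∀ e, (C (algebraMap k B (F.coeff e)) * ∏ j, g j ^ e j).natDegree ≤ e.degree :=
    fun e => (natDegree_C_mul_le _ _).trans (hlin e).1
  rw [hF]
  refine ⟨natDegree_sum_le_of_forall_le _ _ fun e he => (hdeg e).trans (hle e he), ?_⟩
  rw [MvPolynomial.homogeneousComponent_apply, finsetSum_coeff, map_sum, Finset.sum_filter]
  refine Finset.sum_congr rfl fun e he => ?_
  split_ifs with h
  · rw [coeff_C_mul, ← h, (hlin e).2, MvPolynomial.aeval_monomial,
      Finsupp.prod_fintype _ _ fun _ => pow_zero _]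
  · exact coeff_eq_zero_of_natDegree_lt ((hdeg e).trans_lt (lt_of_le_of_ne (hle e he) h))

/-- Transitivity of integrality when there is no map from `C` to `B`: it suffices that the image of
`B` in `D` is integral over `C`. -/
theorem isIntegral_of_isIntegral_of_forall {C B D : Type*} [CommRing C] [CommRing B] [CommRing D]
    [Algebra C D] [Algebra B D] (h : ∀ b : B, IsIntegral C (algebraMap B D b)) {x : D}
    (hx : IsIntegral B x) : IsIntegral C x := by
  let f : B →+* integralClosure C D :=
    (algebraMap B D).codRestrict (integralClosure C D).toSubring h
  let : Algebra B (integralClosure C D) := f.toAlgebra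
  have : IsScalarTower B (integralClosure C D) D := IsScalarTower.of_algebraMap_eq fun _ => rfl
  exact isIntegral_trans (A := integralClosure C D) x hx.tower_top

theorem isIntegral_trans_subalgebra {k D : Type*} [CommRing k] [CommRing D] [Algebra k D]
    {S T : Subalgebra k D} (h : ∀ x ∈ T, IsIntegral S x) {x : D} (hx : IsIntegral T x) :
    IsIntegral S x :=
  isIntegral_of_isIntegral_of_forall (fun b : T => h b b.2) hx

/-- A nontrivial relation `F` among linear forms makes every linear form integral over those in a
hyperplane `ker c`, provided the leading form of `F` does not vanish at the center `c` of the
projection. -/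
theorem isIntegral_of_leading_ne_zero {k D U : Type*} [Field k] [CommRing D] [Algebra k D]
    [AddCommGroup U] [Module k U] (w : U →ₗ[k] D) {M : ℕ} (b : Fin M → U)
    (c : Module.Dual k U) {x₀ : U} (hx₀ : c x₀ = 1) (F : MvPolynomial (Fin M) k)
    (hF : MvPolynomial.aeval (fun j => w (b j)) F = 0)
    (hc : MvPolynomial.eval (fun j => c (b j))
      (MvPolynomial.homogeneousComponent F.totalDegree F) ≠ 0) (u : U) :
    IsIntegral (Algebra.adjoin k (w '' (LinearMap.ker c : Set U))) (w u) := by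
  set B := Algebra.adjoin k (w '' (LinearMap.ker c : Set U))
  have hB : ∀ v : U, w (v - c v • x₀) ∈ B := fun v =>
    Algebra.subset_adjoin ⟨_, by simp [hx₀], rfl⟩
  let β : Fin M → B := fun j => ⟨w (b j - c (b j) • x₀), hB (b j)⟩
  let P := MvPolynomial.aeval (fun j => Polynomial.C (β j) +
    Polynomial.C (algebraMap k B (c (b j))) * Polynomial.X) F
  obtain ⟨h1, h2⟩ := natDegree_aeval_line_le F β (fun j => algebraMap k B (c (b j)))
  have h3 := MvPolynomial.aeval_algebraMap_apply (A := k) B (fun j => c (b j))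
    (MvPolynomial.homogeneousComponent F.totalDegree F)
  rw [MvPolynomial.aeval_eq_eval] at h3
  replace h2 := h2.trans h3
  set a := MvPolynomial.eval (fun j => c (b j))
      (MvPolynomial.homogeneousComponent F.totalDegree F)
  have hx : IsIntegral B (w x₀) := by
    refine ⟨Polynomial.C (algebraMap k B a⁻¹) * P, ?_, ?_⟩
    · refine Polynomial.monic_of_natDegree_le_of_coeff_eq_one F.totalDegree
        ((Polynomial.natDegree_C_mul_le _ _).trans h1) ?_
      rw [Polynomial.coeff_C_mul, h2, ← map_mul, inv_mul_cancel₀ hc, map_one]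
    · rw [Polynomial.eval₂_mul]
      suffices Polynomial.eval₂ (algebraMap B D) (w x₀) P = 0 by rw [this, mul_zero]
      have : ((Polynomial.aeval (R := B) (w x₀)).restrictScalars k).comp
          (MvPolynomial.aeval (fun j => Polynomial.C (β j) +
            Polynomial.C (algebraMap k B (c (b j))) * Polynomial.X)) =
          MvPolynomial.aeval (R := k) (fun j => w (b j)) := by
        ext j
        simp [β, Algebra.smul_def]
      rw [← hF, ← this]
      rfl
  have : w u = algebraMap B D ⟨_, hB u⟩ + algebraMap B D (algebraMap k B (c u)) * w x₀ := by
    rw [← IsScalarTower.algebraMap_apply, ← Algebra.smul_def, ← map_smul]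
    simp
  rw [this]
  exact isIntegral_algebraMap.add (isIntegral_algebraMap.mul hx)

theorem exists_aeval_eq_zero_of_ringKrullDim_lt {k D : Type*} [Field k] [CommRing D] [Algebra k D]
    [Algebra.FiniteType k D] {M : ℕ} (hM : ringKrullDim D < M) (x : Fin M → D) :
    ∃ F : MvPolynomial (Fin M) k, F ≠ 0 ∧ MvPolynomial.aeval x F = 0 := by
  by_contra! h
  refine hM.not_ge (AlgebraicIndependent.card_le_ringKrullDim (k := k) (x := x) ?_)
  rw [AlgebraicIndependent, injective_iff_map_eq_zero]
  exact fun F hF => by_contra fun h0 => h F h0 hF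

theorem homogeneousComponent_totalDegree_ne_zero {k : Type*} [CommRing k] {σ : Type*}
    (F : MvPolynomial σ k) (hF : F ≠ 0) :
    MvPolynomial.homogeneousComponent F.totalDegree F ≠ 0 := by
  classical
  obtain ⟨e, he, hd⟩ := F.support.exists_mem_eq_sup (MvPolynomial.support_nonempty.2 hF)
    fun s => s.sum fun _ e => e
  intro h
  have h2 := congrArg (MvPolynomial.coeff e) h
  rw [MvPolynomial.coeff_homogeneousComponent, if_pos] at h2
  · exact MvPolynomial.mem_support_iff.1 he h2
  · rw [MvPolynomial.totalDegree, hd]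
    rfl

theorem adjoin_image_span {k D V : Type*} [CommRing k] [CommRing D] [Algebra k D]
    [AddCommGroup V] [Module k V] (w : V →ₗ[k] D) (s : Set V) :
    Algebra.adjoin k (w '' (Submodule.span k s : Set V)) = Algebra.adjoin k (w '' s) := by
  rw [← Submodule.map_coe, Submodule.map_span, Algebra.adjoin_span]

theorem finiteType_of_adjoin_range {k D V : Type*} [Field k] [CommRing D] [Algebra k D]
    [AddCommGroup V] [Module k V] [FiniteDimensional k V] (w : V →ₗ[k] D)
    (hw : Algebra.adjoin k (Set.range w) = ⊤) : Algebra.FiniteType k D := by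
  classical
  refine ⟨⟨Finset.univ.image (w ∘ Module.finBasis k V), ?_⟩⟩
  rw [Finset.coe_image, Finset.coe_univ, Set.image_univ, Set.range_comp, ← adjoin_image_span,
    Module.Basis.span_eq, Submodule.top_coe, Set.image_univ, hw]

theorem finrank_map_subtype_ker_lt {k V : Type*} [Field k] [AddCommGroup V] [Module k V]
    [FiniteDimensional k V] {U : Submodule k V} {c : Module.Dual k U} (hc : c ≠ 0) :
    Module.finrank k ((LinearMap.ker c).map U.subtype) < Module.finrank k U := by
  rw [Submodule.finrank_map_subtype_eq]
  exact Submodule.finrank_lt fun h => hc (LinearMap.ker_eq_top.1 h)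

theorem isIntegral_projection {k D V : Type*} [Field k] [CommRing D] [Algebra k D]
    [AddCommGroup V] [Module k V] {U : Submodule k V} {w : V →ₗ[k] D} {M : ℕ}
    (b : Module.Basis (Fin M) k U) {c : Module.Dual k U} {x₀ : U} (hx₀ : c x₀ = 1)
    (F : MvPolynomial (Fin M) k) (hF : MvPolynomial.aeval (fun j => w (b j)) F = 0)
    (hc : MvPolynomial.eval (fun j => c (b j))
      (MvPolynomial.homogeneousComponent F.totalDegree F) ≠ 0)
    (hU : ∀ x : D, IsIntegral (Algebra.adjoin k (w '' U)) x) (x : D) :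
    IsIntegral (Algebra.adjoin k (w '' ((LinearMap.ker c).map U.subtype : Submodule k V))) x := by
  refine isIntegral_trans_subalgebra (T := Algebra.adjoin k (w '' U)) ?_ (hU x)
  have key := isIntegral_of_leading_ne_zero (w ∘ₗ U.subtype) b c hx₀ F hF hc
  rw [LinearMap.coe_comp, Set.image_comp] at key
  have : Algebra.adjoin k (w '' U) ≤ (integralClosure (Algebra.adjoin k (w ''
      ((LinearMap.ker c).map U.subtype : Submodule k V))) D).restrictScalars k := by
    rw [Algebra.adjoin_le_iff]
    rintro _ ⟨u, hu, rfl⟩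
    exact key ⟨u, hu⟩
  exact fun y hy => this hy

/-- Linear Noether normalization over an infinite field: an algebra of dimension at most `r`
generated by a finite-dimensional space is integral over the subalgebra generated by some subspace
of dimension at most `r`. -/
theorem exists_submodule_isIntegral_adjoin {k D V : Type*} [Field k] [Infinite k] [CommRing D]
    [Algebra k D] [AddCommGroup V] [Module k V] [FiniteDimensional k V] (w : V →ₗ[k] D)
    (hw : Algebra.adjoin k (Set.range w) = ⊤) {r : ℕ} (hr : ringKrullDim D ≤ r) :
    ∃ U : Submodule k V, Module.finrank k U ≤ r ∧
      ∀ x : D, IsIntegral (Algebra.adjoin k (w '' U)) x := by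
  have hft : Algebra.FiniteType k D := finiteType_of_adjoin_range w hw
  suffices ∀ (n : ℕ) (U : Submodule k V), Module.finrank k U = n →
      (∀ x : D, IsIntegral (Algebra.adjoin k (w '' U)) x) → ∃ U : Submodule k V,
      Module.finrank k U ≤ r ∧ ∀ x : D, IsIntegral (Algebra.adjoin k (w '' U)) x by
    refine this _ ⊤ rfl fun x => ?_
    have hx : x ∈ Algebra.adjoin k (w '' (⊤ : Submodule k V)) := by
      rw [Submodule.top_coe, Set.image_univ, hw]
      trivial
    exact isIntegral_algebraMap (R := Algebra.adjoin k (w '' (⊤ : Submodule k V))) (x := ⟨x, hx⟩)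
  intro n
  induction n using Nat.strong_induction_on with
  | _ n ih =>
    intro U hU hint
    by_cases hn : n ≤ r
    · exact ⟨U, hU.trans_le hn, hint⟩
    let b := Module.finBasisOfFinrankEq k U hU
    obtain ⟨F, hF0, hF⟩ := exists_aeval_eq_zero_of_ringKrullDim_lt (k := k) (D := D) (M := n)
      (hr.trans_lt (by exact_mod_cast not_le.1 hn)) (fun j => w (b j))
    have hn0 : 0 < n := by omega
    -- The second factor makes the center of projection nonzero.
    obtain ⟨c', hc', -⟩ := exists_forall_eval_ne_zero
      (MvPolynomial.homogeneousComponent F.totalDegree F * MvPolynomial.X ⟨0, hn0⟩)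
      (mul_ne_zero (homogeneousComponent_totalDegree_ne_zero F hF0) (MvPolynomial.X_ne_zero _))
      (ι := Empty) (fun _ => k) (fun i => i.elim) (fun i => i.elim)
    rw [map_mul, MvPolynomial.eval_X] at hc'
    obtain ⟨c, rfl⟩ : ∃ c : Module.Dual k U, (fun j => c (b j)) = c' :=
      ⟨b.constr k c', funext fun j => b.constr_basis k c' j⟩
    have hx₀ : c ((c (b ⟨0, hn0⟩))⁻¹ • b ⟨0, hn0⟩) = 1 := by
      rw [map_smul, smul_eq_mul, inv_mul_cancel₀ (right_ne_zero_of_mul hc')]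
    have hc0 : c ≠ 0 := fun h => by simp [h] at hx₀
    exact ih _ (hU ▸ finrank_map_subtype_ker_lt hc0) _ rfl
      (isIntegral_projection b hx₀ F hF (left_ne_zero_of_mul hc') hint)

end LinearProjection

/-! ### Homogeneous relations after base change -/

section BaseChange

theorem ringKrullDim_baseChange_le {k K A : Type*} [Field k] [Field K] [Algebra k K] [CommRing A]
    [Algebra k A] [Algebra.FiniteType k A] {n : ℕ} (h : ringKrullDim A ≤ n) :
    ringKrullDim (K ⊗[k] A) ≤ n := by
  cases subsingleton_or_nontrivial A
  · have : Subsingleton (K ⊗[k] A) := inferInstance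
    rw [ringKrullDim_eq_bot_of_subsingleton]
    exact bot_le
  obtain ⟨r, g, hr, -, hg⟩ := exists_integral_injective_algHom_of_ringKrullDim k A
  let f : K ⊗[k] MvPolynomial (Fin r) k →ₐ[K] K ⊗[k] A :=
    Algebra.TensorProduct.map (AlgHom.id K K) g
  have h1 : ∀ a : A, f.toRingHom.IsIntegralElem (1 ⊗ₜ a) := by
    intro a
    obtain ⟨p, hp, hpa⟩ := hg a
    refine ⟨p.map (Algebra.TensorProduct.includeRight (R := k) (A := K)).toRingHom, hp.map _, ?_⟩
    rw [Polynomial.eval₂_map]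
    have h2 : f.toRingHom.comp (Algebra.TensorProduct.includeRight (R := k) (A := K)).toRingHom =
        (Algebra.TensorProduct.includeRight (R := k) (A := K) (B := A)).toRingHom.comp
          g.toRingHom := by
      exact RingHom.ext fun x => by simp [f]
    rw [h2]
    have h3 := Polynomial.hom_eval₂ p g.toRingHom
      (Algebra.TensorProduct.includeRight (R := k) (A := K) (B := A)).toRingHom a
    refine h3.symm.trans ?_
    have h4 : Polynomial.eval₂ g.toRingHom a p = 0 := hpa
    rw [h4, map_zero]
  have h2 : f.toRingHom.IsIntegral := by
    intro x
    induction x with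
    | zero => exact RingHom.isIntegralElem_zero _
    | add x y hx hy => exact hx.add _ hy
    | tmul x a =>
      have : x ⊗ₜ[k] a = f.toRingHom (x ⊗ₜ 1) * (1 ⊗ₜ a) := by simp [f]
      rw [this]
      exact (RingHom.isIntegralElem_map _).mul _ (h1 a)
  algebraize [f.toRingHom]
  have : Algebra.IsIntegral (K ⊗[k] MvPolynomial (Fin r) k) (K ⊗[k] A) := ⟨h2⟩
  refine (ringKrullDim_le_of_isIntegral (K ⊗[k] MvPolynomial (Fin r) k) _).trans ?_
  rw [ringKrullDim_eq_of_ringEquiv (MvPolynomial.algebraTensorAlgEquiv k K).toRingEquiv,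
    ringKrullDim_mvPolynomial_field, ← hr]
  exact h

theorem aeval_mul_of_isHomogeneous {K D : Type*} [CommRing K] [CommRing D] [Algebra K D]
    {σ : Type*} [Fintype σ] {d : ℕ} {H : MvPolynomial σ K} (hH : H.IsHomogeneous d) (t : D)
    (z : σ → D) :
    MvPolynomial.aeval (fun j => t * z j) H = t ^ d * MvPolynomial.aeval z H := by
  rw [MvPolynomial.aeval_def, MvPolynomial.aeval_def, MvPolynomial.eval₂_eq',
    MvPolynomial.eval₂_eq', Finset.mul_sum]
  refine Finset.sum_congr rfl fun e he => ?_
  have hd : ∑ j, e j = d := by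
    have := hH (MvPolynomial.mem_support_iff.1 he)
    have h1 : Finsupp.weight (1 : σ → ℕ) = Finsupp.degree := Finsupp.degree_eq_weight_one.symm
    rwa [h1, Finsupp.degree_eq_sum] at this
  simp_rw [mul_pow, Finset.prod_mul_distrib]
  rw [Finset.prod_pow_eq_pow_sum, hd]
  ring

/-- More than `dim D + 1` elements of a finitely generated algebra satisfy a homogeneous relation:
the cone over a variety has dimension one more than the variety. -/
theorem exists_isHomogeneous_aeval_eq_zero {K D : Type*} [Field K] [CommRing D] [Algebra K D]
    [Algebra.FiniteType K D] {r M : ℕ} (hD : ringKrullDim D ≤ r) (hM : r + 1 < M) (z : Fin M → D) :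
    ∃ (d : ℕ) (H : MvPolynomial (Fin M) K), H ≠ 0 ∧ H.IsHomogeneous d ∧
      MvPolynomial.aeval z H = 0 := by
  have : IsNoetherianRing D := Algebra.FiniteType.isNoetherianRing K D
  -- A relation among the `z j * T` in `D[T]` is a homogeneous relation in each degree.
  have hlt : ringKrullDim (Polynomial D) < M := by
    rw [Polynomial.ringKrullDim_of_isNoetherianRing]
    refine (add_le_add_left hD 1).trans_lt ?_
    exact_mod_cast hM
  obtain ⟨F, hF0, hF⟩ := exists_aeval_eq_zero_of_ringKrullDim_lt (k := K) hlt
    fun j => Polynomial.C 0 + Polynomial.C (z j) * Polynomial.X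
  refine ⟨F.totalDegree, _, homogeneousComponent_totalDegree_ne_zero F hF0,
    MvPolynomial.homogeneousComponent_isHomogeneous _ _, ?_⟩
  rw [← (natDegree_aeval_line_le F (fun _ => 0) z).2, hF, Polynomial.coeff_zero]

end BaseChange

/-! ### Separation of points and tangent vectors -/

section Rigidity

universe u

variable {k A V : Type u} [Field k] [CommRing A] [Algebra k A] [AddCommGroup V] [Module k V]
  (w : V →ₗ[k] A) (U : Submodule k V)
  (K : Type u) [Field K] [Algebra k K] [Algebra A K] [IsScalarTower k A K]

/-- The linear system `U` separates tangent vectors at the `K`-valued point `A → K`. -/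
def SeparatesTangents : Prop :=
  ∀ D : Derivation k A K, (∀ u ∈ U, D (w u) = 0) → D = 0

/-- The linear system `U` separates the given `K`-valued point `A → K` from all other points of
`Spec A` with values in extension fields of `K`. -/
def SeparatesPoints : Prop :=
  ∀ (L : Type u) [Field L] [Algebra k L] [Algebra K L] [IsScalarTower k K L] (g : A →ₐ[k] L),
    (∀ u ∈ U, g (w u) = algebraMap K L (algebraMap A K (w u))) →
      ∀ a, g a = algebraMap K L (algebraMap A K a)

variable {w U K}

/-- If a linear system separates points and tangent vectors at a point, then the fibre of the
projection through that point is a single reduced point. -/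
theorem eq_of_separates (hT : SeparatesTangents w U K) (hP : SeparatesPoints w U K)
    {E : Type u} [CommRing E] [IsNoetherianRing E] [Algebra k E] [Algebra K E]
    [IsScalarTower k K E] (g : A →ₐ[k] E)
    (hg : ∀ u ∈ U, g (w u) = algebraMap K E (algebraMap A K (w u))) (a : A) :
    g a = algebraMap K E (algebraMap A K a) := by
  let z : A → E := fun a => g a - algebraMap K E (algebraMap A K a)
  let N : Ideal E := Ideal.span (Set.range z)
  have hzN : ∀ a, z a ∈ N := fun a => Ideal.subset_span ⟨a, rfl⟩
  -- Separation of points, applied at the primes of `E`, puts `N` into the nilradical, and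
  -- separation of tangent vectors, applied to functionals on `E ⧸ N ^ 2`, gives `N = N ^ 2`.
  have hnil : N ≤ nilradical E := by
    rw [Ideal.span_le]
    rintro _ ⟨a, rfl⟩
    change z a ∈ nilradical E
    rw [nilradical_eq_sInf, Ideal.mem_sInf]
    intro P hP'
    have : P.IsPrime := hP'
    rw [← Ideal.algebraMap_residueField_eq_zero, map_sub, sub_eq_zero]
    have := hP P.ResidueField ((IsScalarTower.toAlgHom k E P.ResidueField).comp g) (fun u hu => by
      rw [AlgHom.comp_apply, hg u hu]
      exact (IsScalarTower.algebraMap_apply K E P.ResidueField _).symm) a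
    rw [IsScalarTower.algebraMap_apply K E P.ResidueField] at this
    exact this
  have hzmul : ∀ a b, z (a * b) = algebraMap K E (algebraMap A K a) * z b +
      algebraMap K E (algebraMap A K b) * z a + z a * z b := by
    intro a b
    simp only [z, map_mul]
    ring
  have hsq : N ≤ N ^ 2 := by
    rw [Ideal.span_le]
    rintro _ ⟨a, rfl⟩
    by_contra ha
    have ha' : Ideal.Quotient.mk (N ^ 2) (z a) ≠ 0 := fun h =>
      ha (Ideal.Quotient.eq_zero_iff_mem.1 h)
    obtain ⟨φ, hφ⟩ := Module.Projective.exists_dual_ne_zero K ha'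
    let D : Derivation k A K := Derivation.mk'
      { toFun := fun a => φ (Ideal.Quotient.mk (N ^ 2) (z a))
        map_add' := fun x y => by
          rw [← map_add, ← map_add]
          congr 2
          simp only [z, map_add]
          ring
        map_smul' := fun c x => by
          have : z (c • x) = algebraMap k K c • z x := by
            simp only [z, Algebra.smul_def, map_mul, mul_sub, AlgHom.commutes,
              ← IsScalarTower.algebraMap_apply]
          rw [this, RingHom.id_apply, Algebra.smul_def c, ← smul_eq_mul, ← φ.map_smul]
          rfl }
      (fun a b => by
        have h0 : Ideal.Quotient.mk (N ^ 2) (z a * z b) = 0 :=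
          Ideal.Quotient.eq_zero_iff_mem.2 (by
            rw [pow_two]; exact Ideal.mul_mem_mul (hzN a) (hzN b))
        have h1 : Ideal.Quotient.mk (N ^ 2) (z (a * b)) =
            algebraMap A K a • Ideal.Quotient.mk (N ^ 2) (z b) +
            algebraMap A K b • Ideal.Quotient.mk (N ^ 2) (z a) := by
          rw [hzmul, map_add, h0, add_zero, map_add, ← Algebra.smul_def, ← Algebra.smul_def]
          rfl
        change φ _ = a • φ _ + b • φ _
        rw [h1, map_add, map_smul, map_smul, smul_eq_mul, smul_eq_mul, Algebra.smul_def,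
          Algebra.smul_def])
    have hD : D = 0 := hT D fun u hu => by
      change φ (Ideal.Quotient.mk (N ^ 2) (z (w u))) = 0
      simp [z, hg u hu]
    exact hφ (congrArg (fun E : Derivation k A K => E a) hD)
  obtain ⟨n, hn⟩ := IsNoetherianRing.isNilpotent_nilradical E
  have hidem : IsIdempotentElem N :=
    le_antisymm Ideal.mul_le_left (by rwa [pow_two] at hsq)
  have hN : N ≤ ⊥ := by
    calc N = N ^ (n + 1) := (hidem.pow_succ_eq n).symm
      _ ≤ N ^ n := Ideal.pow_le_pow_right n.le_succ
      _ ≤ nilradical E ^ n := Ideal.pow_right_mono hnil n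
      _ = ⊥ := hn
  exact sub_eq_zero.1 ((Ideal.mem_bot).1 (hN (hzN a)))

end Rigidity

/-! ### Generic projections -/

section Projection

universe u

variable {k A V : Type u} [Field k] [CommRing A] [Algebra k A] [AddCommGroup V] [Module k V]
  {w : V →ₗ[k] A} {U : Submodule k V}
  {K : Type u} [Field K] [Algebra k K] [Algebra A K]

theorem sub_smul_mem_map_ker {c : Module.Dual k U} {x₀ : U} (hx₀ : c x₀ = 1) (u : U) :
    ((u - c u • x₀ : U) : V) ∈ (LinearMap.ker c).map U.subtype :=
  ⟨u - c u • x₀, by simp [hx₀], rfl⟩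

/-- Projection from a center outside the tangent space at a point keeps tangent vectors at that
point separated; such centers exist as soon as `dim U` exceeds the dimension of the tangent
space. -/
theorem exists_polynomial_separatesTangents {M N : ℕ} (b : Module.Basis (Fin M) k U)
    [Module.Finite K (Derivation k A K)] (hder : Module.finrank K (Derivation k A K) ≤ N)
    (hM : N < M) (hT : SeparatesTangents w U K) :
    ∃ G : MvPolynomial (Fin M) K, G ≠ 0 ∧ ∀ (c : Module.Dual k U) (x₀ : U), c x₀ = 1 →
      MvPolynomial.eval (fun j => algebraMap k K (c (b j))) G ≠ 0 →
        SeparatesTangents w ((LinearMap.ker c).map U.subtype) K := by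
  let T : Derivation k A K →ₗ[K] (Fin M → K) :=
    { toFun := fun D j => D (w (b j))
      map_add' := fun _ _ => rfl
      map_smul' := fun _ _ => rfl }
  have hlt : LinearMap.range T < ⊤ := by
    refine lt_top_iff_ne_top.2 fun h => ?_
    have h1 := LinearMap.finrank_range_le T
    rw [h, finrank_top, Module.finrank_fin_fun] at h1
    omega
  obtain ⟨f, hf0, hf⟩ := Submodule.exists_le_ker_of_lt_top _ hlt
  let G : MvPolynomial (Fin M) K :=
    ∑ j, MvPolynomial.C (f (Pi.single j 1)) * MvPolynomial.X j
  have hG : ∀ v : Fin M → K, MvPolynomial.eval v G = f v := by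
    intro v
    conv_rhs => rw [pi_eq_sum_univ' v, map_sum]
    simp only [G, map_sum, map_mul, MvPolynomial.eval_C, MvPolynomial.eval_X, map_smul, smul_eq_mul]
    refine Finset.sum_congr rfl fun j _ => ?_
    rw [mul_comm]
  refine ⟨G, fun h => hf0 (LinearMap.ext fun v => by rw [← hG, h]; simp), ?_⟩
  intro c x₀ hx₀ hc D hD
  have hDu : ∀ u : U, D (w u) = algebraMap k K (c u) * D (w x₀) := by
    intro u
    have h := hD _ (sub_smul_mem_map_ker hx₀ u)
    rw [Submodule.coe_sub, Submodule.coe_smul, map_sub, map_smul, map_sub, D.map_smul,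
      sub_eq_zero] at h
    rw [h, Algebra.smul_def]
  have h1 : T D = D (w x₀) • fun j => algebraMap k K (c (b j)) := by
    ext j
    change D (w (b j)) = D (w x₀) * _
    rw [hDu, mul_comm]
  have h2 : f (T D) = 0 := hf ⟨D, rfl⟩
  rw [h1, map_smul, ← hG, smul_eq_mul] at h2
  have h3 : D (w x₀) = 0 := (mul_eq_zero.1 h2).resolve_right hc
  exact hT D fun u hu => by rw [hDu ⟨u, hu⟩, h3, mul_zero]

variable [IsScalarTower k A K] in
/-- Projection from a center off the cone of secants through a point keeps that point separated
from the others; such centers exist as soon as `dim U > dim A + 1`. -/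
theorem exists_polynomial_separatesPoints [Algebra.FiniteType k A] {M n : ℕ}
    (b : Module.Basis (Fin M) k U) (hA : ringKrullDim A ≤ n)
    (hM : n + 1 < M) (hP : SeparatesPoints w U K) :
    ∃ H : MvPolynomial (Fin M) K, H ≠ 0 ∧ ∀ (c : Module.Dual k U) (x₀ : U), c x₀ = 1 →
      MvPolynomial.eval (fun j => algebraMap k K (c (b j))) H ≠ 0 →
        SeparatesPoints w ((LinearMap.ker c).map U.subtype) K := by
  obtain ⟨d, H, hH0, hHd, hH⟩ := exists_isHomogeneous_aeval_eq_zero (K := K) (D := K ⊗[k] A)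
    (ringKrullDim_baseChange_le hA) hM
    fun j => 1 ⊗ₜ w (b j) - algebraMap A K (w (b j)) ⊗ₜ 1
  refine ⟨H, hH0, fun c x₀ hx₀ hc L _ _ _ _ g hg => ?_⟩
  let h : K ⊗[k] A →ₐ[K] L := Algebra.TensorProduct.lift (Algebra.ofId K L) g
    fun _ _ => Commute.all _ _
  set t : L := g (w x₀) - algebraMap K L (algebraMap A K (w x₀)) with ht
  have hgu : ∀ u : U, g (w u) - algebraMap K L (algebraMap A K (w u)) =
      t * algebraMap K L (algebraMap k K (c u)) := by
    intro u
    have h0 := hg _ (sub_smul_mem_map_ker hx₀ u)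
    simp only [Submodule.coe_sub, Submodule.coe_smul, map_sub, map_smul, Algebra.smul_def,
      map_mul, AlgHom.commutes, ← IsScalarTower.algebraMap_apply] at h0
    rw [ht]
    simp only [← IsScalarTower.algebraMap_apply]
    linear_combination h0
  have hz : ∀ j, h (1 ⊗ₜ w (b j) - algebraMap A K (w (b j)) ⊗ₜ 1) =
      t * algebraMap K L (algebraMap k K (c (b j))) := by
    intro j
    rw [← hgu]
    simp [h, Algebra.ofId_apply]
  have h1 := congrArg h hH
  rw [map_zero, MvPolynomial.comp_aeval_apply, funext hz, aeval_mul_of_isHomogeneous hHd] at h1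
  have h2 : t = 0 := by
    refine eq_zero_of_pow_eq_zero ((mul_eq_zero.1 h1).resolve_right fun h3 => hc ?_)
    have h4 := MvPolynomial.aeval_algebraMap_apply L (fun j => algebraMap k K (c (b j))) H
    rw [MvPolynomial.aeval_eq_eval] at h4
    exact (map_eq_zero (algebraMap K L)).1 (h4.symm.trans h3)
  refine hP L g fun u hu => ?_
  have := hgu ⟨u, hu⟩
  rwa [h2, zero_mul, sub_eq_zero] at this

/-- Generic linear projection: finitely many points of `Spec A`, at which the tangent spaces have
dimension at most `N`, stay separated from all other points and have their tangent vectors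
separated by some linear system of dimension at most `N`, over which `A` is integral. -/
theorem exists_submodule_separates [Infinite k] [FiniteDimensional k V] {w : V →ₗ[k] A}
    (hw : Algebra.adjoin k (Set.range w) = ⊤) {n N : ℕ} (hA : ringKrullDim A ≤ n) (hN : n < N)
    {ι : Type*} [Finite ι] (K : ι → Type u) [∀ i, Field (K i)] [∀ i, Algebra k (K i)]
    [∀ i, Algebra A (K i)] [∀ i, IsScalarTower k A (K i)]
    [∀ i, Module.Finite (K i) (Derivation k A (K i))]
    (hder : ∀ i, Module.finrank (K i) (Derivation k A (K i)) ≤ N) :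
    ∃ U : Submodule k V, Module.finrank k U ≤ N ∧
      (∀ x : A, IsIntegral (Algebra.adjoin k (w '' U)) x) ∧
      ∀ i, SeparatesTangents w U (K i) ∧ SeparatesPoints w U (K i) := by
  have hft : Algebra.FiniteType k A := finiteType_of_adjoin_range w hw
  suffices ∀ (M : ℕ) (U : Submodule k V), Module.finrank k U = M →
      (∀ x : A, IsIntegral (Algebra.adjoin k (w '' U)) x) →
      (∀ i, SeparatesTangents w U (K i) ∧ SeparatesPoints w U (K i)) →
      ∃ U : Submodule k V, Module.finrank k U ≤ N ∧
        (∀ x : A, IsIntegral (Algebra.adjoin k (w '' U)) x) ∧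
        ∀ i, SeparatesTangents w U (K i) ∧ SeparatesPoints w U (K i) by
    refine this _ ⊤ rfl (fun x => ?_) fun i => ⟨fun D hD => ?_, fun L _ _ _ _ g hg a => ?_⟩
    · have hx : x ∈ Algebra.adjoin k (w '' (⊤ : Submodule k V)) := by
        rw [Submodule.top_coe, Set.image_univ, hw]
        trivial
      exact isIntegral_algebraMap (R := Algebra.adjoin k (w '' (⊤ : Submodule k V))) (x := ⟨x, hx⟩)
    · refine Derivation.ext_of_adjoin_eq_top _ hw ?_
      rintro _ ⟨v, rfl⟩
      exact hD v trivial
    · have : g = (IsScalarTower.toAlgHom k (K i) L).comp (IsScalarTower.toAlgHom k A (K i)) := by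
        refine AlgHom.ext_of_adjoin_eq_top hw ?_
        rintro _ ⟨v, rfl⟩
        exact hg v trivial
      rw [this]
      rfl
  intro M
  induction M using Nat.strong_induction_on with
  | _ M ih =>
    intro U hU hint hsep
    by_cases hMN : M ≤ N
    · exact ⟨U, hU.trans_le hMN, hint, hsep⟩
    push Not at hMN
    let b := Module.finBasisOfFinrankEq k U hU
    obtain ⟨F, hF0, hF⟩ := exists_aeval_eq_zero_of_ringKrullDim_lt (k := k) (D := A) (M := M)
      (hA.trans_lt (by exact_mod_cast hN.trans hMN)) (fun j => w (b j))
    choose G hG0 hG using fun i =>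
      exists_polynomial_separatesTangents b (hder i) hMN (hsep i).1
    choose H hH0 hH using fun i =>
      exists_polynomial_separatesPoints b hA (by omega) (hsep i).2
    have hM0 : 0 < M := by omega
    obtain ⟨c', hc', hGH⟩ := exists_forall_eval_ne_zero
      (MvPolynomial.homogeneousComponent F.totalDegree F * MvPolynomial.X ⟨0, hM0⟩)
      (mul_ne_zero (homogeneousComponent_totalDegree_ne_zero F hF0) (MvPolynomial.X_ne_zero _))
      K (fun i => G i * H i) (fun i => mul_ne_zero (hG0 i) (hH0 i))
    rw [map_mul, MvPolynomial.eval_X] at hc'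
    obtain ⟨c, rfl⟩ : ∃ c : Module.Dual k U, (fun j => c (b j)) = c' :=
      ⟨b.constr k c', funext fun j => b.constr_basis k c' j⟩
    have hx₀ : c ((c (b ⟨0, hM0⟩))⁻¹ • b ⟨0, hM0⟩) = 1 := by
      rw [map_smul, smul_eq_mul, inv_mul_cancel₀ (right_ne_zero_of_mul hc')]
    have hc0 : c ≠ 0 := fun h => by simp [h] at hx₀
    refine ih _ (hU ▸ finrank_map_subtype_ker_lt hc0) _ rfl
      (isIntegral_projection b hx₀ F hF (left_ne_zero_of_mul hc') hint) fun i => ?_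
    have h := hGH i
    rw [map_mul] at h
    exact ⟨hG i c _ hx₀ (left_ne_zero_of_mul h), hH i c _ hx₀ (right_ne_zero_of_mul h)⟩

end Projection

/-! ### The conductor of a generic projection -/

section FiniteConductor

/-- `A / B` is a finitely generated `C`-module; here `B` and `C` are subalgebras of `A`, and
`C ⊆ B` in all cases of interest. -/
def QuotientFinite {k A : Type*} [CommRing k] [CommRing A] [Algebra k A]
    (C B : Subalgebra k A) : Prop :=
  ∃ G : Finset A, ∀ a : A, ∃ b ∈ B, a - b ∈ Submodule.span C (G : Set A)

universe u

/-- A finitely generated module has a nonzero functional with values in the residue field of any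
prime of its support. -/
theorem exists_linearMap_residueField_ne_zero {B N : Type*} [CommRing B] [AddCommGroup N]
    [Module B N] [Module.Finite B N] (p : Ideal B) [p.IsPrime]
    (hp : (⟨p, inferInstance⟩ : PrimeSpectrum B) ∈ Module.support B N) :
    ∃ (φ : N →ₗ[B] p.ResidueField) (n : N), φ n ≠ 0 := by
  rw [Module.mem_support_iff_nontrivial_residueField_tensorProduct] at hp
  obtain ⟨x, hx⟩ := exists_ne (0 : p.ResidueField ⊗[B] N)
  obtain ⟨φ, hφ⟩ := Module.Projective.exists_dual_ne_zero p.ResidueField hx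
  by_contra! h
  have h3 : ∀ n : N, φ (1 ⊗ₜ n) = 0 :=
    h (φ.restrictScalars B ∘ₗ TensorProduct.mk B p.ResidueField N 1)
  apply hφ
  clear hφ hx
  induction x using TensorProduct.induction_on with
  | zero => simp
  | tmul c n =>
    have : c ⊗ₜ[B] n = c • ((1 : p.ResidueField) ⊗ₜ[B] n) := by
      rw [TensorProduct.smul_tmul', smul_eq_mul, mul_one]
    rw [this, map_smul, h3, smul_zero]
  | add x y hx hy => rw [map_add, hx, hy, add_zero]

/-- A projection that separates points and tangent vectors at a prime `q` is an isomorphism near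
`q`: some element of the smaller ring outside `q` multiplies the larger ring into the smaller. -/
theorem exists_notMem_forall_mul_mem_of_separates {k A V : Type u} [Field k] [CommRing A]
    [Algebra k A] [AddCommGroup V] [Module k V] {w : V →ₗ[k] A} {U : Submodule k V}
    (B : Subalgebra k A) (hB : B = Algebra.adjoin k (w '' U)) [Module.Finite B A]
    (q : Ideal A) [q.IsPrime] (hT : SeparatesTangents w U q.ResidueField)
    (hP : SeparatesPoints w U q.ResidueField) :
    ∃ b : B, (b : A) ∉ q ∧ ∀ a : A, (b : A) * a ∈ B := by
  let N := A ⧸ LinearMap.range (Algebra.linearMap B A)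
  let p : Ideal B := q.comap (algebraMap B A)
  let E := q.ResidueField ⊗[B] A
  have : IsNoetherianRing E := IsNoetherianRing.of_finite q.ResidueField E
  have key : ∀ a : A, (1 : q.ResidueField) ⊗ₜ[B] a = algebraMap A q.ResidueField a ⊗ₜ[B] 1 := by
    intro a
    have := eq_of_separates hT hP (E := E)
      ((Algebra.TensorProduct.includeRight : A →ₐ[B] E).restrictScalars k) (fun u hu => by
        have hu' : w u ∈ B := hB ▸ Algebra.subset_adjoin ⟨u, hu, rfl⟩
        change (1 : q.ResidueField) ⊗ₜ[B] (w u) = algebraMap A q.ResidueField (w u) ⊗ₜ[B] (1 : A)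
        have h1 : (w u) = (⟨w u, hu'⟩ : B) • (1 : A) := by
          rw [Algebra.smul_def, mul_one]; rfl
        have h2 : algebraMap A q.ResidueField (w u) = (⟨w u, hu'⟩ : B) • (1 : q.ResidueField) := by
          rw [Algebra.smul_def, mul_one]; rfl
        rw [h2, TensorProduct.smul_tmul, ← h1]) a
    exact this
  -- Hence there are no nonzero `B`-linear maps from `A ⧸ B` to the residue field at `q`.
  have hker : ∀ h : A →ₗ[B] q.ResidueField, h 1 = 0 → h = 0 := by
    intro h h1
    ext a
    have h2 := congrArg (LinearMap.mul' B q.ResidueField ∘ₗ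
      TensorProduct.map LinearMap.id h) (key a)
    simpa [h1] using h2
  by_cases hp : (⟨p, inferInstance⟩ : PrimeSpectrum B) ∈ Module.support B N
  · exfalso
    obtain ⟨φ, n, hφ⟩ := exists_linearMap_residueField_ne_zero p hp
    let j : p.ResidueField →ₐ[B] q.ResidueField :=
      { Ideal.ResidueField.map p q (algebraMap B A) rfl with
        commutes' := fun b => Ideal.ResidueField.map_algebraMap p q (algebraMap B A) rfl b }
    obtain ⟨a, rfl⟩ := Submodule.mkQ_surjective _ n
    have h1 := hker ((j.toLinearMap ∘ₗ φ) ∘ₗ Submodule.mkQ _) (by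
      have : Submodule.mkQ (LinearMap.range (Algebra.linearMap B A)) 1 = 0 :=
        (Submodule.Quotient.mk_eq_zero _).2 ⟨1, by simp⟩
      rw [LinearMap.comp_apply, this, map_zero])
    exact hφ (j.toRingHom.injective ((congrArg (fun f => f a) h1).trans (map_zero _).symm))
  · rw [Module.support_eq_zeroLocus, PrimeSpectrum.mem_zeroLocus] at hp
    obtain ⟨b, hb, hbp⟩ := Set.not_subset.1 hp
    refine ⟨b, hbp, fun a => ?_⟩
    have := Module.mem_annihilator.1 hb (Submodule.mkQ _ a)
    rw [← map_smul] at this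
    obtain ⟨c, hc⟩ := (Submodule.Quotient.mk_eq_zero _).1 this
    rw [Algebra.smul_def] at hc
    rw [show (b : A) * a = c from hc.symm]
    exact c.2

/-- An ideal of `B` contained in the contraction of no prime of `A` of dimension `l = dim A`
has dimension less than `l`. -/
theorem ringKrullDim_quotient_lt {B A : Type*} [CommRing B] [CommRing A] [Algebra B A]
    [Algebra.IsIntegral B A] (hinj : Function.Injective (algebraMap B A)) {l : ℕ}
    (hA : ringKrullDim A = l) (c : Ideal B)
    (hc : ∀ q : Ideal A, q.IsPrime → ringKrullDim (A ⧸ q) = l → ¬ c ≤ q.comap (algebraMap B A)) :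
    ringKrullDim (B ⧸ c) < l := by
  by_contra! h
  rw [ringKrullDim_quotient] at h
  obtain ⟨σ, hσ⟩ := Order.le_krullDim_iff.1 h
  let P : PrimeSpectrum B := σ.head.1
  obtain ⟨q, -, hq, hqP⟩ := Ideal.exists_ideal_over_prime_of_isIntegral P.asIdeal (⊥ : Ideal A)
    (by rw [← RingHom.ker_eq_comap_bot, (RingHom.injective_iff_ker_eq_bot _).1 hinj]; exact bot_le)
  refine hc q hq (le_antisymm (hA ▸ ringKrullDim_quotient_le q) ?_) ?_
  · rw [← ringKrullDim_quotient_comap (A := B), hqP, ringKrullDim_quotient]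
    have h1 : ringKrullDim (B ⧸ P.asIdeal) = (Order.coheight P : WithBot ℕ∞) := by
      rw [ringKrullDim_quotient, Order.coheight_eq_krullDim_Ici]
      rfl
    rw [← ringKrullDim_quotient, h1]
    have h2 := Order.length_le_coheight_head (p := σ.map Subtype.val (fun _ _ h => h))
    rw [← hσ]
    exact_mod_cast h2
  · rw [hqP]
    exact σ.head.2

/-- If `A` is finite over `B`, the ideal `c` of `B` satisfies `c A ⊆ B`, and `B / c` is finite over
`C`, then `A / B` is finite over `C`. -/
theorem exists_finset_of_finite_quotient {C B A : Type*} [CommRing C] [CommRing B] [CommRing A]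
    [Algebra C B] [Algebra B A] [Algebra C A] [IsScalarTower C B A] [Module.Finite B A]
    (c : Ideal B) (hc : ∀ b ∈ c, ∀ a : A, algebraMap B A b * a ∈ Set.range (algebraMap B A))
    [Module.Finite C (B ⧸ c)] :
    ∃ G : Finset A, ∀ a : A, ∃ b : B, a - algebraMap B A b ∈ Submodule.span C (G : Set A) := by
  classical
  obtain ⟨g, hg⟩ := Module.Finite.fg_top (R := B) (M := A)
  obtain ⟨h, hh⟩ := Module.Finite.fg_top (R := C) (M := B ⧸ c)
  let r : B ⧸ c → B := Function.surjInv Ideal.Quotient.mk_surjective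
  have hr : ∀ x, Ideal.Quotient.mk c (r x) = x := Function.surjInv_eq Ideal.Quotient.mk_surjective
  let G : Finset A := Finset.image₂ (fun x y => algebraMap B A (r x) * y) h g
  let P : Submodule C A :=
    Submodule.span C (G : Set A) ⊔ LinearMap.range (IsScalarTower.toAlgHom C B A).toLinearMap
  have hcP : ∀ b ∈ c, ∀ a : A, algebraMap B A b * a ∈ P := by
    intro b hb a
    obtain ⟨b', hb'⟩ := hc b hb a
    exact Submodule.mem_sup_right ⟨b', hb'⟩
  have key : ∀ y ∈ g, ∀ d : B ⧸ c, ∀ b : B, Ideal.Quotient.mk c b = d →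
      algebraMap B A b * y ∈ P := by
    intro y hy d
    have hd : d ∈ Submodule.span C (h : Set (B ⧸ c)) := hh ▸ Submodule.mem_top
    have aux : ∀ b b' : B, Ideal.Quotient.mk c b = Ideal.Quotient.mk c b' →
        algebraMap B A b' * y ∈ P → algebraMap B A b * y ∈ P := by
      intro b b' hbb hb'
      have := P.add_mem hb' (hcP (b - b') (Ideal.Quotient.eq.1 hbb) y)
      rwa [← add_mul, ← map_add, add_sub_cancel] at this
    induction hd using Submodule.span_induction with
    | mem x hx =>
      intro b hb
      exact aux b (r x) (by rw [hb, hr]) (Submodule.mem_sup_left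
        (Submodule.subset_span (Finset.mem_image₂_of_mem hx hy)))
    | zero =>
      intro b hb
      exact hcP b (Ideal.Quotient.eq_zero_iff_mem.1 hb) y
    | add x x' _ _ hx hx' =>
      intro b hb
      refine aux b (r x + r x') (by rw [hb, map_add, hr, hr]) ?_
      rw [map_add, add_mul]
      exact P.add_mem (hx _ (hr x)) (hx' _ (hr x'))
    | smul e x _ hx =>
      intro b hb
      refine aux b (e • r x) ?_ ?_
      · have : Ideal.Quotient.mk c (e • r x) = e • Ideal.Quotient.mk c (r x) := rfl
        rw [hb, this, hr]
      · have : algebraMap B A (e • r x) * y = e • (algebraMap B A (r x) * y) := by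
          rw [Algebra.smul_def, Algebra.smul_def, map_mul, ← IsScalarTower.algebraMap_apply,
            mul_assoc]
        rw [this]
        exact P.smul_mem e (hx _ (hr x))
  have htop : ∀ a : A, a ∈ P := by
    intro a
    have ha : a ∈ Submodule.span B (g : Set A) := hg ▸ Submodule.mem_top
    obtain ⟨f, -, rfl⟩ := Submodule.mem_span_finset.1 ha
    refine P.sum_mem fun y hy => ?_
    rw [Algebra.smul_def]
    exact key y hy _ _ rfl
  refine ⟨G, fun a => ?_⟩
  obtain ⟨x, hx, y, ⟨b, rfl⟩, hxy⟩ := Submodule.mem_sup.1 (htop a)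
  refine ⟨b, ?_⟩
  rw [← hxy]
  simpa using hx

/-- A spanning family of a vector space whose first members span a given subspace. -/
theorem exists_spanning_family {k W : Type*} [Field k] [AddCommGroup W] [Module k W]
    [FiniteDimensional k W] (W' : Submodule k W) {N r : ℕ} (hN : Module.finrank k W ≤ N)
    (hr : Module.finrank k W' ≤ r) :
    ∃ v : Fin N → W, Submodule.span k (Set.range v) = ⊤ ∧
      W' ≤ Submodule.span k (v '' {i | (i : ℕ) < r}) := by
  obtain ⟨W'', hW⟩ := Submodule.exists_isCompl W'
  have hdim := Submodule.finrank_add_eq_of_isCompl hW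
  let b₁ := Module.finBasis k W'
  let b₂ := Module.finBasis k W''
  set m₁ := Module.finrank k W'
  set m₂ := Module.finrank k W''
  let v : Fin N → W := fun i =>
    if h : (i : ℕ) < m₁ then b₁ ⟨i, h⟩
    else if h' : (i : ℕ) - m₁ < m₂ then b₂ ⟨i - m₁, h'⟩ else 0
  have h1 : W' ≤ Submodule.span k (v '' {i | (i : ℕ) < r}) := by
    conv_lhs => rw [← Submodule.range_subtype W', LinearMap.range_eq_map, ← b₁.span_eq,
      Submodule.map_span]
    refine Submodule.span_mono ?_
    rintro _ ⟨_, ⟨i, rfl⟩, rfl⟩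
    exact ⟨⟨i, by omega⟩, lt_of_lt_of_le i.2 hr, by simp [v]⟩
  have h2 : W'' ≤ Submodule.span k (Set.range v) := by
    conv_lhs => rw [← Submodule.range_subtype W'', LinearMap.range_eq_map, ← b₂.span_eq,
      Submodule.map_span]
    refine Submodule.span_mono ?_
    rintro _ ⟨_, ⟨i, rfl⟩, rfl⟩
    exact ⟨⟨m₁ + i, by omega⟩, by simp [v]⟩
  refine ⟨v, ?_, h1⟩
  rw [eq_top_iff, ← hW.sup_eq_top]
  exact sup_le (h1.trans (Submodule.span_mono (Set.image_subset_range _ _))) h2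

/-- Integrality over the image of `C` in a finitely generated algebra gives finiteness over `C`. -/
theorem finite_of_isIntegral_map {k B D : Type*} [CommRing k] [CommRing B] [CommRing D]
    [Algebra k B] [Algebra k D] [Algebra B D] [IsScalarTower k B D] [Algebra.FiniteType k D]
    (C : Subalgebra k B) (h : ∀ x : D, IsIntegral (C.map (IsScalarTower.toAlgHom k B D)) x) :
    Module.Finite C D := by
  let π := IsScalarTower.toAlgHom k B D
  let f : C →ₐ[k] C.map π := (π.comp C.val).codRestrict (C.map π) fun x => ⟨x, x.2, rfl⟩
  have hf : Function.Surjective f := by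
    rintro ⟨_, x, hx, rfl⟩
    exact ⟨⟨x, hx⟩, rfl⟩
  let : Algebra C (C.map π) := f.toRingHom.toAlgebra
  have : IsScalarTower C (C.map π) D := IsScalarTower.of_algebraMap_eq fun _ => rfl
  have : Algebra.IsIntegral C (C.map π) := Algebra.isIntegral_of_surjective hf
  have : Algebra.IsIntegral C D := ⟨fun x => isIntegral_trans (A := C.map π) x (h x)⟩
  have : Algebra.FiniteType C D := Algebra.FiniteType.of_restrictScalars_finiteType k C D
  exact Algebra.IsIntegral.finite

/-- If the embedding dimensions at the minimal primes of maximal dimension are at most `s`, then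
some `l + s` linear forms generate a subalgebra `B` over which `A` is finite and which agrees with
`A` outside a locus of smaller dimension, so that `A / B` is finite over the subalgebra generated by
the first `l - 1` of them. -/
theorem exists_quotientFinite_of_embDim_le {k A V : Type u} [Field k] [Infinite k]
    [PerfectField k] [CommRing A] [Algebra k A] [AddCommGroup V] [Module k V]
    [FiniteDimensional k V] {w : V →ₗ[k] A} (hw : Algebra.adjoin k (Set.range w) = ⊤)
    {l s : ℕ} (hA : ringKrullDim A = l) (hl : 0 < l) (hs : 0 < s)
    (h : EmbDimLEAtMinimalPrimes A l s) :
    ∃ v : Fin (l + s) → V, QuotientFinite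
      (Algebra.adjoin k ((fun i => w (v i)) '' {i | (i : ℕ) + 1 < l}))
      (Algebra.adjoin k (Set.range fun i => w (v i))) := by
  classical
  have hft : Algebra.FiniteType k A := finiteType_of_adjoin_range w hw
  have : IsNoetherianRing A := Algebra.FiniteType.isNoetherianRing k A
  let Q := {q : PrimeSpectrum A // ringKrullDim (A ⧸ q.asIdeal) = l}
  have hQmin : ∀ q : Q, q.1.asIdeal ∈ minimalPrimes A := fun q =>
    mem_minimalPrimes_of_ringKrullDim_quotient_eq hA q.1.asIdeal q.2
  have : Finite Q := by
    have hfin := minimalPrimes.finite_of_isNoetherianRing A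
    have := hfin.to_subtype
    exact Finite.of_injective (fun q : Q => (⟨q.1.asIdeal, hQmin q⟩ : minimalPrimes A))
      (fun q q' hqq => Subtype.ext (PrimeSpectrum.ext (congrArg Subtype.val hqq)))
  have hder : ∀ q : Q, Module.Finite q.1.asIdeal.ResidueField
        (Derivation k A q.1.asIdeal.ResidueField) ∧
      Module.finrank q.1.asIdeal.ResidueField (Derivation k A q.1.asIdeal.ResidueField) ≤
        l + s := by
    intro q
    have h1 := finrank_derivation_residueField_le (k := k) q.1.asIdeal
      (trdeg_residueField (k := k) q.1.asIdeal q.2)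
    have h2 := h q.1.asIdeal (hQmin q) q.2
    exact ⟨h1.1, h1.2.trans (by omega)⟩
  have := fun q => (hder q).1
  obtain ⟨U, hU, hint, hsep⟩ := exists_submodule_separates hw hA.le (show l < l + s by omega)
    (fun q : Q => q.1.asIdeal.ResidueField) (fun q => (hder q).2)
  let B := Algebra.adjoin k (w '' U)
  have : Algebra.IsIntegral B A := ⟨hint⟩
  have : Algebra.FiniteType B A := Algebra.FiniteType.of_restrictScalars_finiteType k B A
  have : Module.Finite B A := Algebra.IsIntegral.finite
  -- The conductor of `A` in `B`.
  let c : Ideal B := Module.annihilator B (A ⧸ LinearMap.range (Algebra.linearMap B A))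
  have hc : ∀ b : B, b ∈ c ↔ ∀ a : A, (b : A) * a ∈ B := by
    intro b
    rw [Module.mem_annihilator]
    refine ⟨fun hb a => ?_, fun hb x => ?_⟩
    · have := hb (Submodule.mkQ _ a)
      rw [← map_smul] at this
      obtain ⟨c, hc⟩ := (Submodule.Quotient.mk_eq_zero _).1 this
      rw [Algebra.smul_def] at hc
      rw [show (b : A) * a = c from hc.symm]
      exact c.2
    · obtain ⟨a, rfl⟩ := Submodule.mkQ_surjective _ x
      rw [← map_smul]
      refine (Submodule.Quotient.mk_eq_zero _).2 ⟨⟨_, hb a⟩, ?_⟩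
      rw [Algebra.smul_def]
      rfl
  have hdim : ringKrullDim (B ⧸ c) ≤ (l - 1 : ℕ) := by
    have h1 := ringKrullDim_quotient_lt (B := B) Subtype.val_injective hA c (by
      intro q hq hql hcq
      obtain ⟨b, hbq, hb⟩ := exists_notMem_forall_mul_mem_of_separates B rfl q
        (hsep ⟨⟨q, hq⟩, hql⟩).1 (hsep ⟨⟨q, hq⟩, hql⟩).2
      exact hbq (hcq ((hc b).2 hb)))
    obtain ⟨m, rfl⟩ : ∃ m, l = m + 1 := ⟨l - 1, by omega⟩
    rw [Nat.cast_succ, ENat.WithBot.lt_add_one_iff] at h1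
    simpa using h1
  let wB : U →ₗ[k] B := (w.comp U.subtype).codRestrict (Subalgebra.toSubmodule B)
    (fun u => Algebra.subset_adjoin ⟨u, u.2, rfl⟩)
  have hwB : Algebra.adjoin k (Set.range wB) = ⊤ := by
    have : Set.range wB = Subtype.val ⁻¹' (w '' U) := by
      ext b
      constructor
      · rintro ⟨u, rfl⟩
        exact ⟨u, u.2, rfl⟩
      · rintro ⟨u, hu, hb⟩
        exact ⟨⟨u, hu⟩, Subtype.ext hb⟩
    rw [this]
    exact Algebra.adjoin_adjoin_coe_preimage
  let π : B →ₐ[k] B ⧸ c := IsScalarTower.toAlgHom k B (B ⧸ c)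
  obtain ⟨U', hU', hint'⟩ := exists_submodule_isIntegral_adjoin (π.toLinearMap ∘ₗ wB) (by
    rw [LinearMap.coe_comp, Set.range_comp]
    change Algebra.adjoin k (π '' _) = ⊤
    rw [← AlgHom.map_adjoin, hwB, Algebra.map_top, AlgHom.range_eq_top]
    exact Ideal.Quotient.mk_surjective) hdim
  obtain ⟨v, hv, hvU'⟩ := exists_spanning_family U' hU hU'
  refine ⟨fun i => v i, ?_⟩
  let C : Subalgebra k B := Algebra.adjoin k (wB '' (v '' {i | (i : ℕ) < l - 1}))
  have hfin : Module.Finite C (B ⧸ c) := by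
    have : Algebra.FiniteType k B := finiteType_of_adjoin_range wB hwB
    have : Algebra.FiniteType k (B ⧸ c) := Algebra.FiniteType.of_surjective π
      Ideal.Quotient.mk_surjective
    have hle : Algebra.adjoin k ((π.toLinearMap ∘ₗ wB) '' U') ≤ C.map π := by
      rw [AlgHom.map_adjoin, Set.image_image π wB]
      change _ ≤ Algebra.adjoin k ((fun x => (π.toLinearMap ∘ₗ wB) x) '' _)
      rw [← adjoin_image_span _ (v '' _)]
      exact Algebra.adjoin_mono (Set.image_mono hvU')
    exact finite_of_isIntegral_map C fun x => isIntegral_trans_subalgebra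
      (fun y hy => isIntegral_algebraMap (x := (⟨y, hle hy⟩ : C.map π))) (hint' x)
  obtain ⟨G, hG⟩ := exists_finset_of_finite_quotient (C := C) (A := A) c (fun b hb a =>
    ⟨⟨_, (hc b).1 hb a⟩, rfl⟩)
  refine ⟨G, fun a => ?_⟩
  obtain ⟨b, hb⟩ := hG a
  refine ⟨b, ?_, ?_⟩
  · refine Algebra.adjoin_le ?_ b.2
    rintro _ ⟨u, hu, rfl⟩
    have h1 : (⟨u, hu⟩ : U) ∈ Submodule.span k (Set.range v) := hv ▸ Submodule.mem_top
    have h2 := Submodule.mem_map_of_mem (f := w.comp U.subtype) h1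
    rw [Submodule.map_span, ← Set.range_comp] at h2
    exact Algebra.span_le_adjoin k _ h2
  · refine Submodule.span_induction (p := fun x _ => x ∈ Submodule.span _ (G : Set A))
      (fun x hx => Submodule.subset_span hx) (Submodule.zero_mem _)
      (fun x y _ _ => Submodule.add_mem _) (fun e x _ hx => ?_) hb
    have he : ((e : B) : A) ∈
        Algebra.adjoin k ((fun i => w (v i)) '' {i : Fin (l + s) | (i : ℕ) + 1 < l}) := by
      have h1 : ((e : B) : A) ∈ C.map B.val := ⟨e, e.2, rfl⟩
      rw [AlgHom.map_adjoin, Set.image_image, Set.image_image] at h1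
      refine Algebra.adjoin_mono ?_ h1
      rintro _ ⟨i, hi, rfl⟩
      refine ⟨i, ?_, rfl⟩
      simp only [Set.mem_ofPred_eq] at hi ⊢
      omega
    exact Submodule.smul_mem _ (⟨_, he⟩ : Algebra.adjoin k _) hx

end FiniteConductor

/-! ### Embedding dimensions from a finite quotient -/

section EmbeddingDimension

theorem ringKrullDim_adjoin_range_le {k A : Type*} [Field k] [CommRing A] [Algebra k A] {n : ℕ}
    (x : Fin n → A) : ringKrullDim (Algebra.adjoin k (Set.range x)) ≤ n := by
  rw [Algebra.adjoin_range_eq_range_aeval, ← ringKrullDim_mvPolynomial_field k n]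
  exact ringKrullDim_le_of_surjective (MvPolynomial.aeval x).rangeRestrict.toRingHom
    (MvPolynomial.aeval x).rangeRestrict_surjective

theorem embDim_le_of_surjective {A B : Type*} [CommRing A] [CommRing B] [IsLocalRing A]
    [IsLocalRing B] [IsNoetherianRing A] (f : A →+* B) [IsLocalHom f]
    (hf : Function.Surjective f) : embDim B ≤ embDim A := by
  have hB : IsNoetherianRing B := isNoetherianRing_of_surjective A B f hf
  have h : maximalIdeal B = (maximalIdeal A).map f := by
    refine le_antisymm (fun b hb => ?_) (IsLocalRing.map_maximalIdeal_le f)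
    obtain ⟨a, rfl⟩ := hf b
    exact Ideal.mem_map_of_mem f fun ha => hb (ha.map f)
  rw [embDim, embDim, ← IsLocalRing.spanFinrank_maximalIdeal_eq_finrank_cotangentSpace,
    ← IsLocalRing.spanFinrank_maximalIdeal_eq_finrank_cotangentSpace, h]
  exact Ideal.spanFinrank_map_le_of_fg f (maximalIdeal A).fg_of_isNoetherianRing

/-- A prime of `k[T₁, …, T_{l+s}]` of dimension `l` has embedding dimension at most `s`, since
polynomial rings are regular. -/
theorem embDim_mvPolynomial_le {k : Type*} [Field k] {l s : ℕ}
    (P : Ideal (MvPolynomial (Fin (l + s)) k)) [P.IsPrime]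
    (hP : ringKrullDim (MvPolynomial (Fin (l + s)) k ⧸ P) = l) :
    embDim (Localization.AtPrime P) ≤ s := by
  have h := (inferInstance : IsRegularLocalRing (Localization.AtPrime P)).spanFinrank_maximalIdeal
  rw [IsLocalRing.spanFinrank_maximalIdeal_eq_finrank_cotangentSpace,
    IsLocalization.AtPrime.ringKrullDim_eq_height P] at h
  have h1 := height_add_ringKrullDim_quotient_le P
  rw [← h, hP, ringKrullDim_mvPolynomial_field] at h1
  have h2 : embDim (Localization.AtPrime P) + l ≤ l + s := by exact_mod_cast h1
  omega

/-- If some element outside the prime `q` of `A` multiplies `A` into the image of `S`, then `S → A`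
induces a surjection of the local rings at `q`. -/
theorem localRingHom_surjective {S A : Type*} [CommRing S] [CommRing A] (φ : S →+* A)
    (q : Ideal A) [q.IsPrime] (c : A) (hcq : c ∉ q) (hc : ∀ a, c * a ∈ φ.range) :
    Function.Surjective (Localization.localRingHom (q.comap φ) q φ rfl) := by
  intro z
  obtain ⟨a, t, rfl⟩ := IsLocalization.exists_mk'_eq q.primeCompl z
  obtain ⟨x, hx⟩ := hc a
  obtain ⟨y, hy⟩ := hc t
  have hyq : φ y ∉ q := by
    rw [hy]
    exact fun h => (Ideal.IsPrime.mem_or_mem ‹_› h).elim hcq t.2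
  refine ⟨IsLocalization.mk' _ x (⟨y, hyq⟩ : (q.comap φ).primeCompl), ?_⟩
  rw [Localization.localRingHom_mk', IsLocalization.mk'_eq_iff_eq]
  congr 1
  change (t : A) * φ x = φ y * a
  rw [hx, hy]
  ring

/-- The Cayley-Hamilton theorem for multiplication by `b` on a finitely generated quotient. -/
theorem exists_monic_forall_aeval_mul_mem {C A : Type*} [CommRing C] [CommRing A] [Algebra C A]
    (M : Submodule C A) [Module.Finite C (A ⧸ M)] (b : A) (hb : ∀ x ∈ M, b * x ∈ M) :
    ∃ p : Polynomial C, p.Monic ∧ ∀ a, Polynomial.aeval b p * a ∈ M := by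
  let φ : Module.End C (A ⧸ M) := M.mapQ M (Algebra.lmul C A b) hb
  obtain ⟨p, hp, hpφ⟩ := LinearMap.exists_monic_and_aeval_eq_zero C φ
  have hφ : ∀ (p : Polynomial C) (a : A), Polynomial.aeval φ p (M.mkQ a) =
      M.mkQ (Polynomial.aeval b p * a) := by
    intro p
    induction p using Polynomial.induction_on' with
    | add p q hp hq =>
      intro a
      rw [map_add, LinearMap.add_apply, hp, hq, map_add, add_mul, map_add]
    | monomial n c =>
      have : ∀ (n : ℕ) (a : A), (φ ^ n) (M.mkQ a) = M.mkQ (b ^ n * a) := by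
        intro n
        induction n with
        | zero => intro a; simp
        | succ n ih =>
          intro a
          rw [pow_succ, Module.End.mul_apply, pow_succ, mul_assoc, ← ih]
          rfl
      intro a
      rw [Polynomial.aeval_monomial, Polynomial.aeval_monomial, Module.End.mul_apply, this,
        mul_assoc, ← Algebra.smul_def, map_smul]
      rfl
  refine ⟨p, hp, fun a => ?_⟩
  have := hφ p a
  rw [hpφ, LinearMap.zero_apply] at this
  exact (Submodule.Quotient.mk_eq_zero _).1 this.symm

/-- If `A / B` is finite over `C`, every element of `B` is integral over `C` modulo any ideal of `A`
containing all `b` in `B` with `b A ⊆ B`. -/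
theorem isIntegral_mk_of_quotientFinite {k A : Type*} [CommRing k] [CommRing A] [Algebra k A]
    {C B : Subalgebra k A} (hCB : C ≤ B) (h : QuotientFinite C B) (q : Ideal A)
    (hq : ∀ b ∈ B, (∀ a, b * a ∈ B) → b ∈ q) (b : A) (hb : b ∈ B) :
    IsIntegral C (Ideal.Quotient.mk q b) := by
  classical
  let M : Submodule C A :=
    { carrier := B
      add_mem' := B.add_mem
      zero_mem' := B.zero_mem
      smul_mem' := fun c x hx => B.mul_mem (hCB c.2) hx }
  obtain ⟨G, hG⟩ := h
  have : Module.Finite C (A ⧸ M) := by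
    refine ⟨⟨G.image M.mkQ, ?_⟩⟩
    rw [Finset.coe_image, ← Submodule.map_span, eq_top_iff]
    rintro x -
    obtain ⟨a, rfl⟩ := Submodule.mkQ_surjective _ x
    obtain ⟨b, hb, hab⟩ := hG a
    refine ⟨_, hab, ?_⟩
    rw [map_sub, sub_eq_self]
    exact (Submodule.Quotient.mk_eq_zero _).2 hb
  obtain ⟨p, hp, hpM⟩ := exists_monic_forall_aeval_mul_mem M b fun x hx => B.mul_mem hb hx
  refine ⟨p, hp, ?_⟩
  have h3 := Polynomial.aeval_algHom_apply (IsScalarTower.toAlgHom C A (A ⧸ q)) b p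
  exact h3.trans (Ideal.Quotient.eq_zero_iff_mem.2 (hq _ (by
    have := hpM 1
    rwa [mul_one] at this) hpM))

/-- If `l + s` elements generate a subalgebra `B` of `A` such that `A / B` is finite over the
subalgebra `C` generated by the first `l - 1` of them, the embedding dimensions at the minimal
primes `q` of dimension `l` are at most `s`: for reasons of dimension `q` contains no conductor,
so that `A_q` is a quotient of a localization of `k[T₁, …, T_{l+s}]`. -/
theorem embDim_le_of_quotientFinite {k A : Type*} [Field k] [CommRing A] [Algebra k A]
    {l s : ℕ} (hl : 0 < l) (v : Fin (l + s) → A)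
    (h : QuotientFinite (Algebra.adjoin k (v '' {i | (i : ℕ) + 1 < l}))
      (Algebra.adjoin k (Set.range v))) :
    EmbDimLEAtMinimalPrimes A l s := by
  classical
  intro q hqp _ hql
  set C := Algebra.adjoin k (v '' {i | (i : ℕ) + 1 < l}) with hC
  set B := Algebra.adjoin k (Set.range v) with hB
  have hCB : C ≤ B := Algebra.adjoin_mono (Set.image_subset_range _ _)
  have : Module.Finite B A := by
    obtain ⟨G, hG⟩ := h
    refine ⟨⟨insert 1 G, ?_⟩⟩
    rw [eq_top_iff]
    rintro a -
    obtain ⟨b, hb, hab⟩ := hG a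
    have h1 : b ∈ Submodule.span B ((insert 1 G : Finset A) : Set A) := by
      have := Submodule.smul_mem (Submodule.span B ((insert 1 G : Finset A) : Set A))
        (⟨b, hb⟩ : B) (Submodule.subset_span (by simp : (1 : A) ∈ _))
      rwa [Algebra.smul_def, mul_one] at this
    have h2 : a - b ∈ Submodule.span B ((insert 1 G : Finset A) : Set A) :=
      Submodule.span_induction
        (p := fun x _ => x ∈ Submodule.span B ((insert 1 G : Finset A) : Set A))
        (fun x hx => Submodule.subset_span (Finset.coe_subset.2 (Finset.subset_insert _ _) hx))
        (Submodule.zero_mem _)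
        (fun x y _ _ => Submodule.add_mem _)
        (fun (e : C) x _ hx => Submodule.smul_mem _ (⟨(e : A), hCB e.2⟩ : B) hx) hab
    simpa using Submodule.add_mem _ h1 h2
  obtain ⟨c, hcq, hc⟩ : ∃ c, c ∉ q ∧ ∀ a, c * a ∈ B := by
    by_contra! hcon
    have h1 : ∀ b ∈ B, (∀ a, b * a ∈ B) → b ∈ q := by
      intro b _ hba
      by_contra hbq
      obtain ⟨a, ha⟩ := hcon b hbq
      exact ha (hba a)
    have h2 : Algebra.IsIntegral C (A ⧸ q) := ⟨fun x => by
      refine isIntegral_of_isIntegral_of_forall (B := B)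
        (fun b => isIntegral_mk_of_quotientFinite hCB h q h1 b b.2) ?_
      obtain ⟨a, rfl⟩ := Ideal.Quotient.mk_surjective x
      exact (Algebra.IsIntegral.isIntegral (R := B) a).map (IsScalarTower.toAlgHom B A (A ⧸ q))⟩
    have h3 := ringKrullDim_le_of_isIntegral C (A ⧸ q)
    have h4 : ringKrullDim C ≤ (l - 1 : ℕ) := by
      have : v '' {i | (i : ℕ) + 1 < l} = Set.range
          (fun i : Fin (l - 1) => v ⟨i, by omega⟩) := by
        ext x
        constructor
        · rintro ⟨i, hi, rfl⟩
          exact ⟨⟨i, by simp only [Set.mem_ofPred_eq] at hi; omega⟩, rfl⟩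
        · rintro ⟨i, rfl⟩
          exact ⟨_, by simp only [Set.mem_ofPred_eq]; omega, rfl⟩
      rw [hC, this]
      exact ringKrullDim_adjoin_range_le _
    have h5 := h3.trans h4
    rw [hql] at h5
    have h6 : l ≤ l - 1 := by exact_mod_cast h5
    omega
  let φ : MvPolynomial (Fin (l + s)) k →ₐ[k] A := MvPolynomial.aeval v
  have hφ : φ.range = B := (Algebra.adjoin_range_eq_range_aeval k v).symm
  let : Algebra (MvPolynomial (Fin (l + s)) k) A := φ.toRingHom.toAlgebra
  have : Algebra.IsIntegral (MvPolynomial (Fin (l + s)) k) A := ⟨fun x => by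
    refine isIntegral_of_isIntegral_of_forall (B := B) (fun b => ?_)
      (Algebra.IsIntegral.isIntegral x)
    obtain ⟨p, hp⟩ : (b : A) ∈ φ.range := by
      rw [hφ]
      exact b.2
    rw [show algebraMap B A b = algebraMap (MvPolynomial (Fin (l + s)) k) A p from hp.symm]
    exact isIntegral_algebraMap⟩
  have hP : ringKrullDim (MvPolynomial (Fin (l + s)) k ⧸ q.comap φ.toRingHom) = l := by
    rw [← hql]
    exact ringKrullDim_quotient_comap q
  exact (embDim_le_of_surjective _ (localRingHom_surjective φ.toRingHom q c hcq fun a => by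
    have := hc a
    rw [← hφ] at this
    exact this)).trans (embDim_mvPolynomial_le _ hP)

end EmbeddingDimension

/-! ### Reductions in standard graded algebras -/

section Graded

/-- The relation `W ^ n = S * W ^ (n - 1) + T ^ n` propagates from `n` to all larger exponents; this
applies to ideals and to subspaces of an algebra. -/
theorem pow_le_mul_pow_add_pow {M : Type*} [IdemCommSemiring M] {W S T : M} (hT : T ≤ W) {n : ℕ}
    (hn : 1 ≤ n) (h : W ^ n ≤ S * W ^ (n - 1) + T ^ n) {m : ℕ} (hm : n ≤ m) :
    W ^ m ≤ S * W ^ (m - 1) + T ^ m := by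
  induction m, hm using Nat.le_induction with
  | base => exact h
  | succ m hm ih =>
    obtain ⟨j, rfl⟩ : ∃ j, m = j + 1 := ⟨m - 1, by omega⟩
    rw [Nat.add_sub_cancel] at ih ⊢
    have h1 : W * T ^ (j + 1) ≤ T * W ^ (j + 1) := by
      calc W * T ^ (j + 1) = T * (W * T ^ j) := by ring
        _ ≤ T * (W * W ^ j) := by gcongr
        _ = T * W ^ (j + 1) := by ring
    have h2 : T * W ^ (j + 1) ≤ S * W ^ (j + 1) + T ^ (j + 1 + 1) := by
      calc T * W ^ (j + 1) ≤ T * (S * W ^ j + T ^ (j + 1)) := by gcongr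
        _ = S * (T * W ^ j) + T ^ (j + 1 + 1) := by ring
        _ ≤ S * (W * W ^ j) + T ^ (j + 1 + 1) := by gcongr
        _ = S * W ^ (j + 1) + T ^ (j + 1 + 1) := by ring
    calc W ^ (j + 1 + 1) = W * W ^ (j + 1) := by ring
      _ ≤ W * (S * W ^ j + T ^ (j + 1)) := by gcongr
      _ = S * W ^ (j + 1) + W * T ^ (j + 1) := by ring
      _ ≤ S * W ^ (j + 1) + T ^ (j + 1 + 1) := by
        rw [add_eq_sup, add_eq_sup] at *
        exact sup_le le_sup_left (h1.trans h2)

theorem exists_mem_pow_of_mem_closure {k A : Type*} [CommSemiring k] [CommSemiring A] [Algebra k A]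
    {W : Submodule k A} {x : A} (hx : x ∈ Submonoid.closure (W : Set A)) : ∃ m, x ∈ W ^ m := by
  induction hx using Submonoid.closure_induction with
  | mem x hx => exact ⟨1, by rwa [pow_one]⟩
  | one => exact ⟨0, by rw [pow_zero]; exact Submodule.one_le.1 le_rfl⟩
  | mul x y _ _ hx hy =>
    obtain ⟨m, hm⟩ := hx
    obtain ⟨n, hn⟩ := hy
    exact ⟨m + n, by rw [pow_add]; exact Submodule.mul_mem_mul hm hn⟩

/-- The condition `A_n = (v_1, …, v_{l-1}) A_{n-1} + (v_l, …, v_t)^n` on elements `v_i` of the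
degree one part `W` of a standard graded algebra, for a single `n`, makes `A / k[v]` finite over
`k[v_1, …, v_{l-1}]`. -/
theorem quotientFinite_of_pow_le {k A : Type*} [Field k] [CommRing A] [Algebra k A]
    {W : Submodule k A} [FiniteDimensional k W] (hW : Algebra.adjoin k (W : Set A) = ⊤)
    {s t : Set A} (ht : t ⊆ W) {n : ℕ} (hn : 1 ≤ n)
    (h : W ^ n ≤ Submodule.span k s * W ^ (n - 1) ⊔ Submodule.span k t ^ n) :
    QuotientFinite (Algebra.adjoin k s) (Algebra.adjoin k (s ∪ t)) := by
  classical
  have hfg : (W).FG := Module.Finite.iff_fg.1 inferInstance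
  have hfgn : (⨆ i : Fin n, W ^ (i : ℕ)).FG := Submodule.fg_iSup _ fun i => hfg.pow _
  obtain ⟨G, hG⟩ := hfgn
  refine ⟨G, ?_⟩
  let C := Algebra.adjoin k s
  let B := Algebra.adjoin k (s ∪ t)
  have hCB : C ≤ B := Algebra.adjoin_mono Set.subset_union_left
  let P : Submodule k A := (Submodule.span C (G : Set A)).restrictScalars k ⊔ B.toSubmodule
  have hP : ∀ c ∈ C, ∀ x ∈ P, c * x ∈ P := by
    intro c hc x hx
    obtain ⟨y, hy, z, hz, rfl⟩ := Submodule.mem_sup.1 hx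
    rw [mul_add]
    exact Submodule.add_mem_sup (Submodule.smul_mem (Submodule.span C (G : Set A)) ⟨c, hc⟩ hy)
      (B.mul_mem (hCB hc) hz)
  have hWP : ∀ m, W ^ m ≤ P := by
    intro m
    induction m using Nat.strong_induction_on with
    | _ m ih =>
      by_cases hm : m < n
      · have h1 : W ^ m ≤ Submodule.span k (G : Set A) := by
          rw [hG]
          exact le_iSup (fun i : Fin n => W ^ (i : ℕ)) ⟨m, hm⟩
        exact (h1.trans (Submodule.span_le_restrictScalars k C _)).trans le_sup_left
      · refine (pow_le_mul_pow_add_pow (Submodule.span_le.2 ht) hn h (not_lt.1 hm)).trans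
          (sup_le ?_ ?_)
        · rw [Submodule.mul_le]
          intro x hx y hy
          exact hP x (Algebra.span_le_adjoin k s hx) y (ih (m - 1) (by omega) hy)
        · refine le_trans ?_ le_sup_right
          intro x hx
          refine Submodule.pow_induction_on_left (C := fun x => x ∈ B) (Submodule.span k t)
            (fun r => B.algebraMap_mem r) (fun x y => B.add_mem) (fun m hm x hx => ?_) hx
          exact B.mul_mem (Algebra.adjoin_mono Set.subset_union_right
            (Algebra.span_le_adjoin k t hm)) hx
  intro a
  have ha : a ∈ P := by
    have h1 : a ∈ Subalgebra.toSubmodule (Algebra.adjoin k (W : Set A)) := by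
      rw [hW]; exact Submodule.mem_top
    rw [Algebra.adjoin_eq_span] at h1
    refine Submodule.span_le.2 ?_ h1
    intro x hx
    obtain ⟨m, hm⟩ := exists_mem_pow_of_mem_closure hx
    exact hWP m hm
  obtain ⟨y, hy, z, hz, rfl⟩ := Submodule.mem_sup.1 ha
  exact ⟨z, hz, by simpa using hy⟩

end Graded

/-! ### Zariski openness of spanning conditions -/

section Openness

variable {k W A : Type*} [Field k] [AddCommGroup W] [Module k W] [CommRing A] [Algebra k A]

variable (k W) in
/-- The algebra of polynomial functions on the vector space `W`. -/
noncomputable def polyFun : Subalgebra k (W → k) :=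
  Algebra.adjoin k (Set.range fun φ : Module.Dual k W => (φ : W → k))

theorem exists_eval_eq_of_mem_polyFun {q : W → k} (hq : q ∈ polyFun k W) :
    ∃ p : MvPolynomial (Module.Dual k W) k, ∀ w, q w = MvPolynomial.eval (fun φ => φ w) p := by
  rw [polyFun, Algebra.adjoin_range_eq_range_aeval] at hq
  obtain ⟨p, rfl⟩ := hq
  refine ⟨p, fun w => ?_⟩
  have := MvPolynomial.comp_aeval_apply (fun φ : Module.Dual k W => (φ : W → k))
    (Pi.evalAlgHom k (fun _ : W => k) w) p
  rw [← MvPolynomial.aeval_eq_eval]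
  exact this

variable (k W A) in
/-- The polynomial maps from the vector space `W` to the (possibly infinite-dimensional) algebra
`A`: sums of products of polynomial functions on `W` and elements of `A`. -/
noncomputable def polyMap : Submodule k (W → A) :=
  Submodule.span k {h | ∃ q ∈ polyFun k W, ∃ a : A, h = fun w => q w • a}

theorem const_mem_polyMap (a : A) : (fun _ => a) ∈ polyMap k W A :=
  Submodule.subset_span ⟨1, one_mem _, a, by simp⟩

theorem mul_mem_polyMap {f g : W → A} (hf : f ∈ polyMap k W A) (hg : g ∈ polyMap k W A) :
    f * g ∈ polyMap k W A := by
  have h := Submodule.mul_mem_mul hf hg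
  rw [polyMap, Submodule.span_mul_span] at h
  refine Submodule.span_mono ?_ h
  rintro _ ⟨_, ⟨q, hq, a, rfl⟩, _, ⟨q', hq', a', rfl⟩, rfl⟩
  exact ⟨q * q', mul_mem hq hq', a * a', by ext w; simp [mul_smul_mul_comm]⟩

theorem linear_mem_polyMap [FiniteDimensional k W] (f : W →ₗ[k] A) :
    (f : W → A) ∈ polyMap k W A := by
  let b := Module.finBasis k W
  have : (f : W → A) = ∑ i, fun w => (b.coord i : W → k) w • f (b i) := by
    ext w
    conv_lhs => rw [← b.sum_repr w, map_sum]
    simp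
  rw [this]
  exact Submodule.sum_mem _ fun i _ => Submodule.subset_span
    ⟨_, Algebra.subset_adjoin ⟨b.coord i, rfl⟩, f (b i), rfl⟩

theorem dual_comp_mem_polyFun {h : W → A} (hh : h ∈ polyMap k W A) (φ : Module.Dual k A) :
    (fun w => φ (h w)) ∈ polyFun k W := by
  induction hh using Submodule.span_induction with
  | mem h hh =>
    obtain ⟨q, hq, a, rfl⟩ := hh
    have : (fun w => φ (q w • a)) = φ a • q := by ext w; simp [mul_comm]
    rw [this]
    exact Subalgebra.smul_mem _ hq _
  | zero =>
    simp only [Pi.zero_apply, map_zero]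
    exact zero_mem (polyFun k W)
  | add f g _ _ hf hg => simpa using! add_mem hf hg
  | smul c f _ hf => simpa using! Subalgebra.smul_mem _ hf c

/-- A family of subspaces of `A` parametrized by `W` that is spanned by values of polynomial
maps. -/
def PolySpanned (N : W → Submodule k A) : Prop :=
  ∀ w₀, ∀ x ∈ N w₀, ∃ h ∈ polyMap k W A, h w₀ = x ∧ ∀ w, h w ∈ N w

theorem PolySpanned.const (M : Submodule k A) : PolySpanned fun _ : W => M :=
  fun _ x hx => ⟨_, const_mem_polyMap x, rfl, fun _ => hx⟩

theorem PolySpanned.sup {N N' : W → Submodule k A} (h : PolySpanned N) (h' : PolySpanned N') :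
    PolySpanned fun w => N w ⊔ N' w := by
  intro w₀ x hx
  obtain ⟨y, hy, z, hz, rfl⟩ := Submodule.mem_sup.1 hx
  obtain ⟨f, hf, rfl, hfN⟩ := h w₀ y hy
  obtain ⟨g, hg, rfl, hgN⟩ := h' w₀ z hz
  exact ⟨f + g, add_mem hf hg, rfl, fun w => Submodule.add_mem_sup (hfN w) (hgN w)⟩

theorem PolySpanned.mul {N N' : W → Submodule k A} (h : PolySpanned N) (h' : PolySpanned N') :
    PolySpanned fun w => N w * N' w := by
  intro w₀ x hx
  induction hx using Submodule.mul_induction_on' with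
  | mem_mul_mem y hy z hz =>
    obtain ⟨f, hf, rfl, hfN⟩ := h w₀ y hy
    obtain ⟨g, hg, rfl, hgN⟩ := h' w₀ z hz
    exact ⟨f * g, mul_mem_polyMap hf hg, rfl, fun w => Submodule.mul_mem_mul (hfN w) (hgN w)⟩
  | add y _ z _ hy hz =>
    obtain ⟨f, hf, rfl, hfN⟩ := hy
    obtain ⟨g, hg, rfl, hgN⟩ := hz
    exact ⟨f + g, add_mem hf hg, rfl, fun w => Submodule.add_mem _ (hfN w) (hgN w)⟩

theorem PolySpanned.pow {N : W → Submodule k A} (h : PolySpanned N) (n : ℕ) :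
    PolySpanned fun w => N w ^ n := by
  induction n with
  | zero => simpa only [pow_zero] using PolySpanned.const 1
  | succ n ih => simpa only [pow_succ] using ih.mul h

theorem PolySpanned.span {ι : Type*} {f : ι → W → A} (hf : ∀ i, f i ∈ polyMap k W A)
    (s : Set ι) : PolySpanned fun w => Submodule.span k ((fun i => f i w) '' s) := by
  intro w₀ x hx
  induction hx using Submodule.span_induction with
  | mem x hx =>
    obtain ⟨i, hi, rfl⟩ := hx
    exact ⟨f i, hf i, rfl, fun w => Submodule.subset_span ⟨i, hi, rfl⟩⟩
  | zero => exact ⟨0, zero_mem _, rfl, fun w => zero_mem _⟩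
  | add x y _ _ hx hy =>
    obtain ⟨f, hf, rfl, hfN⟩ := hx
    obtain ⟨g, hg, rfl, hgN⟩ := hy
    exact ⟨f + g, add_mem hf hg, rfl, fun w => Submodule.add_mem _ (hfN w) (hgN w)⟩
  | smul c x _ hx =>
    obtain ⟨f, hf, rfl, hfN⟩ := hx
    exact ⟨c • f, Submodule.smul_mem _ c hf, rfl, fun w => Submodule.smul_mem _ c (hfN w)⟩

/-- Spanning a fixed finite-dimensional space `M` is an open condition on a polynomially spanned
family of subspaces of `M`: it is detected by a determinant. -/
theorem PolySpanned.exists_polynomial {N : W → Submodule k A} (hN : PolySpanned N)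
    (M : Submodule k A) (hM : M.FG) (hNM : ∀ w, N w ≤ M) (w₀ : W) (hw₀ : M ≤ N w₀) :
    ∃ p : MvPolynomial (Module.Dual k W) k, MvPolynomial.eval (fun φ => φ w₀) p ≠ 0 ∧
      ∀ w, MvPolynomial.eval (fun φ => φ w) p ≠ 0 → M ≤ N w := by
  classical
  have : FiniteDimensional k M := Module.Finite.iff_fg.2 hM
  let b := Module.finBasis k M
  choose h hh hb hhN using fun j => hN w₀ (b j) (hw₀ (b j).2)
  choose φ hφ using fun j => LinearMap.exists_extend (b.coord j)
  -- The coordinates, with respect to a basis of `M`, of the moving vectors `h j w`.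
  let q : Matrix (Fin (Module.finrank k M)) (Fin (Module.finrank k M)) (W → k) :=
    Matrix.of fun i j w => φ i (h j w)
  have hq : q.det ∈ polyFun k W := by
    rw [Matrix.det_apply]
    exact sum_mem fun σ _ => Subalgebra.zsmul_mem _
      (prod_mem fun i _ => dual_comp_mem_polyFun (hh _) _) _
  obtain ⟨p, hp⟩ := exists_eval_eq_of_mem_polyFun hq
  have hdet : ∀ w, q.det w = (Matrix.of fun i j => φ i (h j w)).det := by
    intro w
    exact RingHom.map_det (Pi.evalRingHom (fun _ : W => k) w) q
  refine ⟨p, ?_, fun w hw => ?_⟩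
  · rw [← hp, hdet]
    have : (Matrix.of fun i j => φ i (h j w₀)) = 1 := by
      ext i j
      have := congrArg (fun f => f (b j)) (hφ i)
      simp only [LinearMap.comp_apply, Submodule.subtype_apply] at this
      rw [Matrix.of_apply, hb, this, Module.Basis.coord_apply, b.repr_self, Matrix.one_apply,
        Finsupp.single_apply]
      simp only [eq_comm]
    rw [this, Matrix.det_one]
    exact one_ne_zero
  · rw [← hp, hdet] at hw
    let g : Fin (Module.finrank k M) → M := fun j => ⟨h j w, hNM w (hhN j w)⟩
    have hg : LinearIndependent k g := by
      rw [Fintype.linearIndependent_iff]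
      intro c hc
      have : c = 0 := Matrix.eq_zero_of_mulVec_eq_zero hw (by
        ext i
        have := congrArg (fun x : M => φ i x) hc
        simpa [Matrix.mulVec, dotProduct, g, mul_comm] using this)
      simp [this]
    have htop := hg.span_eq_top_of_card_eq_finrank' (by simp)
    intro x hx
    have hx' : (⟨x, hx⟩ : M) ∈ Submodule.span k (Set.range g) := htop ▸ Submodule.mem_top
    have h2 := Submodule.mem_map_of_mem (f := M.subtype) hx'
    rw [Submodule.map_span] at h2
    refine Submodule.span_le.2 ?_ h2
    rintro _ ⟨_, ⟨j, rfl⟩, rfl⟩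
    exact hhN j w

theorem isZariskiOpen_of_forall_exists {U : Set W}
    (h : ∀ w₀ ∈ U, ∃ p : MvPolynomial (Module.Dual k W) k,
      MvPolynomial.eval (fun φ => φ w₀) p ≠ 0 ∧
        ∀ w, MvPolynomial.eval (fun φ => φ w) p ≠ 0 → w ∈ U) : IsZariskiOpen k U := by
  refine ⟨{p | ∀ w, MvPolynomial.eval (fun φ => φ w) p ≠ 0 → w ∈ U}, ?_⟩
  ext w
  constructor
  · intro hw
    obtain ⟨p, hp, hpU⟩ := h w hw
    exact ⟨p, hpU, hp⟩
  · rintro ⟨p, hp, hpw⟩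
    exact hp w hpw

end Openness

/-! ### The special fiber ring as a standard graded algebra -/

section FiberAlgebra

variable {R : Type*} [CommRing R] [IsLocalRing R]

noncomputable instance (I : Ideal R) : Algebra R (FiberRing I) :=
  inferInstanceAs (Algebra R (reesAlgebra I ⧸ fiberIdeal I))

/-- The projection `R[It] → 𝓕(I)`. -/
noncomputable def fiberMk (I : Ideal R) : reesAlgebra I →ₐ[R] FiberRing I :=
  Ideal.Quotient.mkₐ R (fiberIdeal I)

theorem fiberMk_surjective (I : Ideal R) : Function.Surjective (fiberMk I) :=
  Ideal.Quotient.mk_surjective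

theorem fiberMk_eq_zero {I : Ideal R} {x : reesAlgebra I} :
    fiberMk I x = 0 ↔ x ∈ fiberIdeal I :=
  Ideal.Quotient.eq_zero_iff_mem

noncomputable instance (I : Ideal R) : Algebra (ResidueField R) (FiberRing I) :=
  (Ideal.Quotient.lift (maximalIdeal R) (algebraMap R (FiberRing I)) fun _ hr =>
    fiberMk_eq_zero.2 (Ideal.mem_map_of_mem (algebraMap R (reesAlgebra I))
      (Ideal.mem_sup_right hr))).toAlgebra

instance (I : Ideal R) : IsScalarTower R (ResidueField R) (FiberRing I) :=
  IsScalarTower.of_algebraMap_eq fun _ => rfl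

/-- The map `fiberMap` as a homomorphism of algebras over the residue field. -/
noncomputable def fiberAlgHom {J I : Ideal R} (h : J ≤ I) :
    FiberRing J →ₐ[ResidueField R] FiberRing I :=
  { fiberMap h with
    commutes' := fun c => by
      obtain ⟨r, rfl⟩ := IsLocalRing.residue_surjective c
      rfl }

theorem fiberMap_fiberMk {J I : Ideal R} (h : J ≤ I) (x : reesAlgebra J) :
    fiberMap h (fiberMk J x) = fiberMk I (Subalgebra.inclusion (reesAlgebra_le h) x) :=
  rfl

theorem fiberMap_fiberMap {H J I : Ideal R} (h : H ≤ J) (h' : J ≤ I) (x : FiberRing H) :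
    fiberMap h' (fiberMap h x) = fiberMap (h.trans h') x := by
  obtain ⟨y, rfl⟩ := fiberMk_surjective _ x
  rw [fiberMap_fiberMk, fiberMap_fiberMk, fiberMap_fiberMk, Subalgebra.inclusion_inclusion]

theorem fiberAlgHom_apply {J I : Ideal R} (h : J ≤ I) (x : FiberRing J) :
    fiberAlgHom h x = fiberMap h x :=
  rfl

/-- The class of `r tⁿ` in `𝓕(I)`, for `r` in `Iⁿ`. -/
noncomputable def fiberMonomial (I : Ideal R) (n : ℕ) : ↥(I ^ n) →ₗ[R] FiberRing I where
  toFun r := fiberMk I ⟨Polynomial.monomial n (r : R), reesAlgebra.monomial_mem.2 r.2⟩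
  map_add' r s := by
    rw [← map_add]
    congr 1
    exact Subtype.ext (map_add _ _ _)
  map_smul' c r := by
    rw [RingHom.id_apply, ← map_smul]
    congr 1
    exact Subtype.ext (map_smul _ _ _)

theorem fiberMonomial_mul {I : Ideal R} {m n : ℕ} (r : ↥(I ^ m)) (s : ↥(I ^ n)) :
    fiberMonomial I (m + n) ⟨r * s, by rw [pow_add]; exact Ideal.mul_mem_mul r.2 s.2⟩ =
      fiberMonomial I m r * fiberMonomial I n s := by
  simp only [fiberMonomial, LinearMap.coe_mk, AddHom.coe_mk]
  rw [← map_mul]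
  congr 1
  exact Subtype.ext (Polynomial.monomial_mul_monomial m n (r : R) (s : R)).symm

/-- The natural map from `I ⊗ k` to the degree one part of `𝓕(I)`. -/
noncomputable def fiberLinear (I : Ideal R) :
    ResidueField R ⊗[R] I →ₗ[ResidueField R] FiberRing I :=
  LinearMap.liftBaseChange (ResidueField R)
    (fiberMonomial I 1 ∘ₗ Submodule.inclusion (pow_one I).ge)

theorem fiberLinear_one_tmul {I : Ideal R} (x : I) :
    fiberLinear I (1 ⊗ₜ x) = fiberMonomial I 1 ⟨x, (pow_one I).ge x.2⟩ := by
  rw [fiberLinear, LinearMap.liftBaseChange_tmul, one_smul]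
  rfl

/-- The ideal of all `r` in `Iⁿ` such that the class of `r tⁿ` lies in a subspace of `𝓕(I)`. -/
noncomputable def liftIdeal {I : Ideal R} (n : ℕ) (M : Submodule (ResidueField R) (FiberRing I)) :
    Ideal R :=
  ((M.restrictScalars R).comap (fiberMonomial I n)).map (I ^ n).subtype

theorem mem_liftIdeal {I : Ideal R} {n : ℕ} {M : Submodule (ResidueField R) (FiberRing I)} {r : R} :
    r ∈ liftIdeal n M ↔ ∃ h : r ∈ I ^ n, fiberMonomial I n ⟨r, h⟩ ∈ M := by
  constructor
  · rintro ⟨x, hx, rfl⟩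
    exact ⟨x.2, hx⟩
  · rintro ⟨h, hr⟩
    exact ⟨⟨r, h⟩, hr, rfl⟩

theorem liftIdeal_mono {I : Ideal R} {n : ℕ} {M N : Submodule (ResidueField R) (FiberRing I)}
    (h : M ≤ N) : liftIdeal n M ≤ liftIdeal n N := by
  intro r hr
  obtain ⟨hn, hr⟩ := mem_liftIdeal.1 hr
  exact mem_liftIdeal.2 ⟨hn, h hr⟩

/-- Together with `pow_le_liftIdeal`, this transfers relations between ideals of `R` to relations
between subspaces of the special fiber ring. -/
theorem liftIdeal_mul_le {I : Ideal R} {m n : ℕ}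
    (M N : Submodule (ResidueField R) (FiberRing I)) :
    liftIdeal m M * liftIdeal n N ≤ liftIdeal (m + n) (M * N) := by
  rw [Ideal.mul_le]
  intro r hr s hs
  obtain ⟨hrm, hr⟩ := mem_liftIdeal.1 hr
  obtain ⟨hsn, hs⟩ := mem_liftIdeal.1 hs
  refine mem_liftIdeal.2 ⟨by rw [pow_add]; exact Ideal.mul_mem_mul hrm hsn, ?_⟩
  have := fiberMonomial_mul ⟨r, hrm⟩ ⟨s, hsn⟩
  exact this ▸ Submodule.mul_mem_mul hr hs

theorem pow_le_liftIdeal {I J : Ideal R} {M : Submodule (ResidueField R) (FiberRing I)}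
    (h : J ≤ liftIdeal 1 M) (n : ℕ) : J ^ n ≤ liftIdeal n (M ^ n) := by
  induction n with
  | zero =>
    intro r _
    refine mem_liftIdeal.2 ⟨by simp, ?_⟩
    rw [pow_zero, Submodule.mem_one]
    exact ⟨residue R r, rfl⟩
  | succ n ih =>
    rw [pow_succ, pow_succ]
    exact (Ideal.mul_mono ih h).trans (liftIdeal_mul_le _ _)

theorem le_liftIdeal_range (I : Ideal R) : I ≤ liftIdeal 1 (LinearMap.range (fiberLinear I)) :=
  fun r hr => mem_liftIdeal.2 ⟨(pow_one I).ge hr, 1 ⊗ₜ ⟨r, hr⟩, fiberLinear_one_tmul _⟩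

theorem range_fiberLinear_eq_span (I : Ideal R) : LinearMap.range (fiberLinear I) =
    Submodule.span (ResidueField R) (Set.range (fiberMonomial I 1)) := by
  refine le_antisymm ?_ (Submodule.span_le.2 ?_)
  · rintro _ ⟨x, rfl⟩
    induction x using TensorProduct.induction_on with
    | zero => rw [map_zero]; exact zero_mem _
    | tmul c x =>
      have : c ⊗ₜ[R] x = c • ((1 : ResidueField R) ⊗ₜ[R] x) := by
        rw [TensorProduct.smul_tmul', smul_eq_mul, mul_one]
      rw [this, map_smul, fiberLinear_one_tmul]
      exact Submodule.smul_mem _ _ (Submodule.subset_span ⟨_, rfl⟩)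
    | add x y hx hy => rw [map_add]; exact add_mem hx hy
  · rintro _ ⟨x, rfl⟩
    exact ⟨1 ⊗ₜ ⟨x, (pow_one I).le x.2⟩, fiberLinear_one_tmul _⟩

theorem range_pow_le {I : Ideal R} {n : ℕ} {M : Submodule (ResidueField R) (FiberRing I)}
    (h : I ^ n ≤ liftIdeal n M) : LinearMap.range (fiberLinear I) ^ n ≤ M := by
  have key : ∀ n, LinearMap.range (fiberLinear I) ^ n ≤
      Submodule.span (ResidueField R) (Set.range (fiberMonomial I n)) := by
    intro n
    induction n with
    | zero =>
      rw [pow_zero, Submodule.one_le]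
      exact Submodule.subset_span ⟨⟨1, by simp⟩, rfl⟩
    | succ n ih =>
      rw [pow_succ]
      refine (mul_le_mul' ih (range_fiberLinear_eq_span I).le).trans ?_
      rw [Submodule.span_mul_span]
      refine Submodule.span_mono ?_
      rintro _ ⟨_, ⟨r, rfl⟩, _, ⟨s, rfl⟩, rfl⟩
      exact ⟨_, fiberMonomial_mul r s⟩
  refine (key n).trans (Submodule.span_le.2 ?_)
  rintro _ ⟨r, rfl⟩
  exact (mem_liftIdeal.1 (h r.2)).2

/-- The special fiber ring is generated by its degree one part. -/
theorem adjoin_range_fiberLinear (I : Ideal R) :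
    Algebra.adjoin (ResidueField R) (Set.range (fiberLinear I)) = ⊤ := by
  rw [eq_top_iff]
  rintro x -
  obtain ⟨p, rfl⟩ := fiberMk_surjective I x
  have hp : p = ∑ n ∈ (p : Polynomial R).support,
      ⟨Polynomial.monomial n ((p : Polynomial R).coeff n), reesAlgebra.monomial_mem.2 (p.2 n)⟩ := by
    apply Subtype.ext
    rw [AddSubmonoidClass.coe_finsetSum]
    exact Polynomial.as_sum_support (p : Polynomial R)
  rw [hp, map_sum]
  refine sum_mem fun n _ => ?_
  have h1 := (mem_liftIdeal.1 (pow_le_liftIdeal (le_liftIdeal_range I) n (p.2 n))).2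
  have h2 : LinearMap.range (fiberLinear I) ^ n ≤ Subalgebra.toSubmodule
      (Algebra.adjoin (ResidueField R) (Set.range (fiberLinear I))) := by
    intro y hy
    refine Submodule.pow_induction_on_left
      (C := fun x => x ∈ Algebra.adjoin (ResidueField R) (Set.range (fiberLinear I))) _
      (fun r => Subalgebra.algebraMap_mem _ r) (fun x y => add_mem) (fun m hm x hx => ?_) hy
    exact mul_mem (Algebra.subset_adjoin hm) hx
  exact h2 h1

theorem coeff_mem_of_mem_fiberIdeal {I : Ideal R} {x : reesAlgebra I} (hx : x ∈ fiberIdeal I)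
    (n : ℕ) : (x : Polynomial R).coeff n ∈ (I ⊔ maximalIdeal R) * I ^ n := by
  induction hx using Submodule.span_induction generalizing n with
  | mem x hx =>
    obtain ⟨r, hr, rfl⟩ := hx
    change (Polynomial.C r).coeff n ∈ _
    rw [Polynomial.coeff_C]
    split_ifs with h
    · rw [h, pow_zero, mul_one]
      exact hr
    · exact zero_mem _
  | zero => simp
  | add x y _ _ hx hy =>
    change ((x : Polynomial R) + y).coeff n ∈ _
    rw [Polynomial.coeff_add]
    exact add_mem (hx n) (hy n)
  | smul p x _ hx =>
    change ((p : Polynomial R) * x).coeff n ∈ _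
    rw [Polynomial.coeff_mul]
    refine sum_mem fun ij hij => ?_
    rw [← Finset.HasAntidiagonal.mem_antidiagonal.1 hij, pow_add, mul_left_comm]
    exact Ideal.mul_mem_mul (p.2 _) (hx _)

theorem le_maximalIdeal_of_nontrivial {I : Ideal R} [Nontrivial (FiberRing I)] :
    I ≤ maximalIdeal R := by
  refine le_maximalIdeal fun h => one_ne_zero (α := FiberRing I) ?_
  rw [← map_one (fiberMk I), fiberMk_eq_zero, fiberIdeal, h, top_sup_eq, Ideal.map_top]
  trivial

end FiberAlgebra

/-! ### Finiteness of cokernels -/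

section Coker

/-- Finiteness of the cokernel, written out with generators in the target ring. -/
theorem cokerFinite_iff {A B C : Type*} [CommRing A] [CommRing B] [CommRing C]
    (α : A →+* B) (φ : B →+* C) : CokerFinite α φ ↔
      ∃ (n : ℕ) (g : Fin n → C), ∀ x, ∃ (b : B) (c : Fin n → A),
        x = φ b + ∑ i, φ (α (c i)) * g i := by
  let : Algebra B C := φ.toAlgebra
  let N := C ⧸ LinearMap.range (Algebra.linearMap B C)
  let : Module A N := Module.compHom _ α
  have hsum : ∀ {n : ℕ} (g : Fin n → C) (c : Fin n → A),
      ∑ i, c i • (Submodule.Quotient.mk (g i) : N) =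
        Submodule.Quotient.mk (∑ i, φ (α (c i)) * g i) := by
    intro n g c
    rw [← Submodule.mkQ_apply, map_sum]
    rfl
  change Module.Finite A N ↔ _
  constructor
  · intro h
    obtain ⟨n, s, hs⟩ := Module.Finite.exists_fin (R := A) (M := N)
    choose g hg using fun i => Submodule.Quotient.mk_surjective _ (s i)
    refine ⟨n, g, fun x => ?_⟩
    have hx : (Submodule.Quotient.mk x : N) ∈ Submodule.span A (Set.range s) :=
      hs ▸ Submodule.mem_top
    obtain ⟨c, hc⟩ := (Submodule.mem_span_range_iff_exists_fun A).1 hx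
    simp only [← hg] at hc
    rw [hsum, eq_comm, Submodule.Quotient.eq] at hc
    obtain ⟨b, hb⟩ := hc
    exact ⟨b, c, (sub_eq_iff_eq_add.1 hb.symm)⟩
  · rintro ⟨n, g, hg⟩
    refine Module.Finite.of_fg_top ?_
    refine (Submodule.fg_def).2 ⟨Set.range fun i => (Submodule.Quotient.mk (g i) : N),
      Set.finite_range _, ?_⟩
    rw [eq_top_iff]
    rintro y -
    obtain ⟨x, rfl⟩ := Submodule.Quotient.mk_surjective _ y
    obtain ⟨b, c, hx⟩ := hg x
    refine (Submodule.mem_span_range_iff_exists_fun A).2 ⟨c, ?_⟩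
    rw [hsum, eq_comm, Submodule.Quotient.eq]
    exact ⟨b, by rw [hx]; exact (add_sub_cancel_right _ _).symm⟩

end Coker

/-! ### Reductions and the special fiber ring -/

section Reduction

theorem fullIdeal_eq_sup {R : Type*} [CommRing R] {I : Ideal R} {t : ℕ} (l : ℕ)
    (f : Fin t → I) : fullIdeal f = headIdeal l f ⊔ tailIdeal l f := by
  rw [fullIdeal, headIdeal, tailIdeal, ← Ideal.span_union]
  congr 1
  ext x
  constructor
  · rintro ⟨i, rfl⟩
    exact (lt_or_ge ((i : ℕ) + 1) l).imp (fun h => ⟨i, h, rfl⟩) (fun h => ⟨i, h, rfl⟩)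
  · rintro (⟨i, _, rfl⟩ | ⟨i, _, rfl⟩) <;> exact ⟨i, rfl⟩

variable {R : Type*} [CommRing R] [IsLocalRing R] {I : Ideal R} {l t : ℕ}

/-- The condition `A_n = (v_1, …, v_{l-1}) A_{n-1} + (v_l, …, v_t)^n` on the linear forms `v_i`
defined by `w` in the special fiber ring `A`. -/
def IsReductionAt (I : Ideal R) (l n : ℕ) (w : Fin t → ResidueField R ⊗[R] I) : Prop :=
  LinearMap.range (fiberLinear I) ^ n ≤
    Submodule.span (ResidueField R) ((fun i => fiberLinear I (w i)) '' {i | (i : ℕ) + 1 < l}) *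
        LinearMap.range (fiberLinear I) ^ (n - 1) ⊔
      Submodule.span (ResidueField R) ((fun i => fiberLinear I (w i)) '' {i | l ≤ (i : ℕ) + 1}) ^ n

theorem span_le_liftIdeal (f : Fin t → I) (p : Fin t → Prop) :
    Ideal.span {x | ∃ i, p i ∧ x = (f i : R)} ≤ liftIdeal (I := I) 1
      (Submodule.span (ResidueField R)
        ((fun i => fiberLinear I (tupleImage f i)) '' {i | p i})) := by
  rw [Ideal.span_le]
  rintro _ ⟨i, hi, rfl⟩
  exact mem_liftIdeal.2 ⟨(pow_one I).ge (f i).2, Submodule.subset_span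
    ⟨i, hi, fiberLinear_one_tmul (f i)⟩⟩

theorem isReductionAt_of_pow_eq (f : Fin t → I) {n : ℕ} (hn : 1 ≤ n)
    (h : I ^ n = headIdeal l f * I ^ (n - 1) + tailIdeal l f ^ n) :
    IsReductionAt I l n (tupleImage f) := by
  obtain ⟨j, rfl⟩ : ∃ j, n = 1 + j := ⟨n - 1, by omega⟩
  refine range_pow_le (h.le.trans ?_)
  rw [Nat.add_sub_cancel_left] at h ⊢
  refine sup_le ?_ ?_
  · refine (Ideal.mul_mono (span_le_liftIdeal f _)
      (pow_le_liftIdeal (le_liftIdeal_range I) j)).trans (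
        (liftIdeal_mul_le _ _).trans (liftIdeal_mono le_sup_left))
  · exact (pow_le_liftIdeal (span_le_liftIdeal f _) _).trans (liftIdeal_mono le_sup_right)

/-- Tuples satisfying the reduction equation in some positive degree form a Zariski open set. -/
theorem isZariskiOpen_isReductionAt [IsNoetherianRing R] (I : Ideal R) (l t : ℕ) :
    IsZariskiOpen (ResidueField R)
      {w : Fin t → ResidueField R ⊗[R] I | ∃ n, 1 ≤ n ∧ IsReductionAt I l n w} := by
  refine isZariskiOpen_of_forall_exists ?_
  rintro w₀ ⟨n, hn, hw₀⟩
  have hpoly : ∀ i : Fin t, (fun w : Fin t → ResidueField R ⊗[R] I => fiberLinear I (w i)) ∈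
      polyMap (ResidueField R) (Fin t → ResidueField R ⊗[R] I) (FiberRing I) := fun i =>
    linear_mem_polyMap (fiberLinear I ∘ₗ
      (LinearMap.proj i : (Fin t → ResidueField R ⊗[R] I) →ₗ[ResidueField R] _))
  have hspan := fun s => PolySpanned.span hpoly s
  have hle : ∀ (w : Fin t → ResidueField R ⊗[R] I) (s : Set (Fin t)),
      Submodule.span (ResidueField R) ((fun i => fiberLinear I (w i)) '' s) ≤
        LinearMap.range (fiberLinear I) := by
    intro w s
    rw [Submodule.span_le]
    rintro _ ⟨i, _, rfl⟩
    exact ⟨w i, rfl⟩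
  obtain ⟨p, hp, hpw⟩ := PolySpanned.exists_polynomial
    (((hspan {i | (i : ℕ) + 1 < l}).mul
      (PolySpanned.const (LinearMap.range (fiberLinear I) ^ (n - 1)))).sup
      ((hspan {i | l ≤ (i : ℕ) + 1}).pow n))
    (LinearMap.range (fiberLinear I) ^ n) ((Module.Finite.iff_fg.1 inferInstance).pow n)
    (fun w => by
      refine sup_le ?_ (pow_le_pow_left' (hle w _) n)
      obtain ⟨j, rfl⟩ : ∃ j, n = 1 + j := ⟨n - 1, by omega⟩
      rw [Nat.add_sub_cancel_left, pow_add, pow_one]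
      exact mul_le_mul' (hle w _) le_rfl) w₀ hw₀
  exact ⟨p, hp, fun w hw => ⟨n, hn, hpw w hw⟩⟩

/-- The finiteness of `A / k[v]` over `k[v_1, …, v_{l-1}]` for the linear forms `v_i` defined by `w`
in the special fiber ring `A`. -/
def HasFiniteQuotient (I : Ideal R) (l : ℕ) (w : Fin t → ResidueField R ⊗[R] I) : Prop :=
  QuotientFinite
    (Algebra.adjoin (ResidueField R) ((fun i => fiberLinear I (w i)) '' {i | (i : ℕ) + 1 < l}))
    (Algebra.adjoin (ResidueField R) (Set.range fun i => fiberLinear I (w i)))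

theorem IsReductionAt.hasFiniteQuotient [IsNoetherianRing R] {n : ℕ} (hn : 1 ≤ n)
    {w : Fin t → ResidueField R ⊗[R] I} (h : IsReductionAt I l n w) : HasFiniteQuotient I l w := by
  have h1 := quotientFinite_of_pow_le (W := LinearMap.range (fiberLinear I))
    (adjoin_range_fiberLinear I) (by
      rintro _ ⟨i, _, rfl⟩
      exact ⟨w i, rfl⟩) hn h
  rw [← Set.image_union] at h1
  have h2 : ({i | (i : ℕ) + 1 < l} ∪ {i | l ≤ (i : ℕ) + 1} : Set (Fin t)) = Set.univ := by
    ext i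
    simp [lt_or_ge]
  rwa [h2, Set.image_univ] at h1

theorem adjoin_le_range_fiberAlgHom {J : Ideal R} (h : J ≤ I) (f : Fin t → I) (s : Set (Fin t))
    (hs : ∀ i ∈ s, (f i : R) ∈ J) :
    Algebra.adjoin (ResidueField R) ((fun i => fiberLinear I (tupleImage f i)) '' s) ≤
      (fiberAlgHom h).range := by
  refine Algebra.adjoin_le ?_
  rintro _ ⟨i, hi, rfl⟩
  exact ⟨fiberMonomial J 1 ⟨f i, (pow_one J).ge (hs i hi)⟩, (fiberLinear_one_tmul (f i)).symm⟩

theorem HasFiniteQuotient.cokerFinite {f : Fin t → I} (h : HasFiniteQuotient I l (tupleImage f)) :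
    CokerFinite (fiberMap (headIdeal_le l f)) (fiberMap (fullIdeal_le f)) := by
  obtain ⟨G, hG⟩ := h
  rw [cokerFinite_iff]
  refine ⟨G.card, fun i => G.equivFin.symm i, fun x => ?_⟩
  obtain ⟨b, hb, hx⟩ := hG x
  rw [← Set.image_univ] at hb
  obtain ⟨b', hb'⟩ := (AlgHom.mem_range _).1 (adjoin_le_range_fiberAlgHom (fullIdeal_le f) f
    Set.univ (fun i _ => Ideal.subset_span ⟨i, rfl⟩) hb)
  have hG' : (G : Set (FiberRing I)) = Set.range fun i => (G.equivFin.symm i : FiberRing I) := by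
    ext y
    exact ⟨fun hy => ⟨G.equivFin ⟨y, hy⟩, by simp⟩, by rintro ⟨i, rfl⟩; exact (G.equivFin.symm i).2⟩
  rw [hG', Submodule.mem_span_range_iff_exists_fun] at hx
  obtain ⟨c, hc⟩ := hx
  choose c' hc' using fun i => (AlgHom.mem_range _).1 (adjoin_le_range_fiberAlgHom
    ((headIdeal_le l f).trans (fullIdeal_le f)) f {i | (i : ℕ) + 1 < l}
    (fun i hi => Ideal.subset_span ⟨i, hi, rfl⟩) (c i).2)
  refine ⟨b', c', ?_⟩
  rw [← sub_eq_iff_eq_add', ← fiberAlgHom_apply, hb', ← hc]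
  refine Finset.sum_congr rfl fun i _ => ?_
  rw [fiberMap_fiberMap, ← fiberAlgHom_apply, hc', Algebra.smul_def]
  rfl

/-- In degrees above those of the generators of the cokernel, all coefficients from the subring are
of positive degree; Nakayama's lemma lifts the resulting equation from the special fiber ring to
`R`. -/
theorem eventually_pow_eq_of_cokerFinite [IsNoetherianRing R] [Nontrivial (FiberRing I)]
    {f : Fin t → I}
    (h : CokerFinite (fiberMap (headIdeal_le l f)) (fiberMap (fullIdeal_le f))) :
    ∀ᶠ n : ℕ in Filter.atTop, I ^ n = headIdeal l f * I ^ (n - 1) + tailIdeal l f ^ n := by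
  obtain ⟨m, g, hg⟩ := (cokerFinite_iff _ _).1 h
  choose p hp using fun i => fiberMk_surjective I (g i)
  have hhI : headIdeal l f ≤ I := (headIdeal_le l f).trans (fullIdeal_le f)
  have htI : tailIdeal l f ≤ I :=
    le_trans (le_sup_right.trans (fullIdeal_eq_sup l f).ge) (fullIdeal_le f)
  filter_upwards [Filter.eventually_gt_atTop
    (Finset.univ.sup fun i => (p i : Polynomial R).natDegree)] with n hn
  have hn1 : 1 ≤ n := by omega
  have hdeg : ∀ i, (p i : Polynomial R).natDegree < n := fun i =>
    (Finset.le_sup (f := fun i => (p i : Polynomial R).natDegree) (Finset.mem_univ i)).trans_lt hn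
  refine le_antisymm ?_ (sup_le ?_ (Ideal.pow_right_mono htI n))
  swap
  · obtain ⟨j, rfl⟩ : ∃ j, n = j + 1 := ⟨n - 1, by omega⟩
    rw [Nat.add_sub_cancel, pow_succ']
    exact Ideal.mul_mono_left hhI
  refine Submodule.le_of_le_smul_of_le_jacobson_bot (IsNoetherian.noetherian _)
    (IsLocalRing.jacobson_eq_maximalIdeal _ bot_ne_top).ge ?_
  intro r hr
  obtain ⟨b, c, hx⟩ := hg (fiberMonomial I n ⟨r, hr⟩)
  obtain ⟨b', rfl⟩ := fiberMk_surjective _ b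
  choose c' hc' using fun i => fiberMk_surjective _ (c i)
  let q : reesAlgebra I := ⟨Polynomial.monomial n r, reesAlgebra.monomial_mem.2 hr⟩
  let y : reesAlgebra I := q - (Subalgebra.inclusion (reesAlgebra_le (fullIdeal_le f)) b' +
    ∑ i, Subalgebra.inclusion (reesAlgebra_le hhI) (c' i) * p i)
  have hy : y ∈ fiberIdeal I := by
    rw [← fiberMk_eq_zero, map_sub, map_add, map_sum, sub_eq_zero]
    refine hx.trans ?_
    rw [fiberMap_fiberMk, add_right_inj]
    refine Finset.sum_congr rfl fun i _ => ?_
    rw [map_mul, hp, ← hc' i, fiberMap_fiberMap, fiberMap_fiberMk]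
  have hcoeff := coeff_mem_of_mem_fiberIdeal hy n
  rw [sup_eq_right.2 le_maximalIdeal_of_nontrivial] at hcoeff
  have hyc : (y : Polynomial R).coeff n =
      r - ((b' : Polynomial R).coeff n + ∑ i, ((c' i : Polynomial R) * p i).coeff n) := by
    have : (y : Polynomial R) = Polynomial.monomial n r - ((b' : Polynomial R) +
        ∑ i, (c' i : Polynomial R) * p i) := by
      simp only [y, q, AddSubgroupClass.coe_sub]
      congr 1
      rw [Subalgebra.coe_add, AddSubmonoidClass.coe_finsetSum]
      rfl
    rw [this, Polynomial.coeff_sub, Polynomial.coeff_add, Polynomial.coeff_monomial_same,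
      Polynomial.finsetSum_coeff]
  have hmain : (b' : Polynomial R).coeff n + ∑ i, ((c' i : Polynomial R) * p i).coeff n ∈
      headIdeal l f * I ^ (n - 1) + tailIdeal l f ^ n := by
    refine add_mem ?_ (sum_mem fun i _ => ?_)
    · have h1 := pow_le_mul_pow_add_pow (S := headIdeal l f) (T := tailIdeal l f)
        (le_sup_right.trans (fullIdeal_eq_sup l f).ge) le_rfl (by simp [fullIdeal_eq_sup l f]) hn1
      exact (h1.trans (sup_le_sup_right (Ideal.mul_mono_right
        (Ideal.pow_right_mono (fullIdeal_le f) _)) _)) (b'.2 n)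
    · rw [Polynomial.coeff_mul]
      refine sum_mem fun ij hij => ?_
      have hij' := Finset.HasAntidiagonal.mem_antidiagonal.1 hij
      -- If the coefficient has degree zero, the generator has no term of degree `n`.
      by_cases h0 : ij.1 = 0
      · rw [Polynomial.coeff_eq_zero_of_natDegree_lt (n := ij.2) (p := (p i : Polynomial R)) (by
          have := hdeg i
          omega), mul_zero]
        exact zero_mem _
      · refine Ideal.mem_sup_left ?_
        have h1 := Ideal.mul_mem_mul ((c' i).2 ij.1) ((p i).2 ij.2)
        obtain ⟨e, he⟩ : ∃ e, ij.1 = e + 1 := ⟨ij.1 - 1, by omega⟩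
        have hn' : n - 1 = e + ij.2 := by omega
        rw [he, pow_succ', mul_assoc] at h1
        rw [he, hn', pow_add]
        exact Ideal.mul_mono_right (Ideal.mul_mono_left (Ideal.pow_right_mono hhI e)) h1
  have hr' : r = ((b' : Polynomial R).coeff n + ∑ i, ((c' i : Polynomial R) * p i).coeff n) +
      (y : Polynomial R).coeff n := by rw [hyc]; ring
  rw [hr']
  exact Submodule.add_mem_sup hmain hcoeff

theorem tupleImage_surjective : Function.Surjective (tupleImage (I := I) (t := t)) := by
  have key : ∀ x : ResidueField R ⊗[R] I, ∃ y : I, (1 : ResidueField R) ⊗ₜ[R] y = x := by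
    intro x
    induction x using TensorProduct.induction_on with
    | zero => exact ⟨0, TensorProduct.tmul_zero _ _⟩
    | tmul c y =>
      obtain ⟨r, rfl⟩ := IsLocalRing.residue_surjective c
      refine ⟨r • y, ?_⟩
      rw [← TensorProduct.smul_tmul, Algebra.smul_def, mul_one]
      rfl
    | add x y hx hy =>
      obtain ⟨a, rfl⟩ := hx
      obtain ⟨b, rfl⟩ := hy
      exact ⟨a + b, TensorProduct.tmul_add _ _ _⟩
  intro w
  choose f hf using fun i => key (w i)
  exact ⟨f, funext hf⟩

theorem isZariskiOpen_univ (k W : Type*) [Field k] [AddCommGroup W] [Module k W] :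
    IsZariskiOpen k (Set.univ : Set W) :=
  isZariskiOpen_of_forall_exists fun _ _ => ⟨1, by simp, fun _ _ => trivial⟩

end Reduction

end SpecialFiber

theorem theorem2p7 {R : Type*} [CommRing R] [IsLocalRing R] [IsNoetherianRing R]
    [Infinite (IsLocalRing.ResidueField R)] [PerfectField (IsLocalRing.ResidueField R)]
    (I : Ideal R) (l s : ℕ) (hl : SpecialFiber.analyticSpread I = l) (hl_pos : 0 < l)
    (hs : 0 < s) :
    SpecialFiber.ForGeneral I (l + s) fun f =>
      List.TFAE [
        ∀ᶠ n : ℕ in Filter.atTop,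
          I ^ n = SpecialFiber.headIdeal l f * I ^ (n - 1) + SpecialFiber.tailIdeal l f ^ n,
        SpecialFiber.CokerFinite
          (SpecialFiber.fiberMap (SpecialFiber.headIdeal_le l f))
          (SpecialFiber.fiberMap (SpecialFiber.fullIdeal_le f)),
        SpecialFiber.EmbDimLEAtMinimalPrimes (SpecialFiber.FiberRing I) l s] := by
  open SpecialFiber in
  have hne : Nontrivial (FiberRing I) := by
    rw [← not_subsingleton_iff_nontrivial]
    intro h
    have h1 := ringKrullDim_eq_bot_of_subsingleton (R := FiberRing I)
    rw [show ringKrullDim (FiberRing I) = l from hl] at h1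
    exact WithBot.coe_ne_bot h1
  -- Being a reduction in some positive degree is an open condition on the tuple, equivalent to each
  -- of the first two conditions.
  have h12 : ∀ f : Fin (l + s) → I,
      (∀ᶠ n : ℕ in Filter.atTop, I ^ n = headIdeal l f * I ^ (n - 1) + tailIdeal l f ^ n) →
        ∃ n, 1 ≤ n ∧ IsReductionAt I l n (tupleImage f) := by
    intro f hf
    obtain ⟨n, hn, hn1⟩ := (hf.and (Filter.eventually_ge_atTop 1)).exists
    exact ⟨n, hn1, isReductionAt_of_pow_eq f hn1 hn⟩
  have h23 : ∀ w : Fin (l + s) → ResidueField R ⊗[R] I,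
      (∃ n, 1 ≤ n ∧ IsReductionAt I l n w) → HasFiniteQuotient I l w :=
    fun w ⟨n, hn, h⟩ => h.hasFiniteQuotient hn
  have h34 : ∀ f : Fin (l + s) → I, HasFiniteQuotient I l (tupleImage f) →
      CokerFinite (fiberMap (headIdeal_le l f)) (fiberMap (fullIdeal_le f)) :=
    fun f h => h.cokerFinite
  have h41 : ∀ f : Fin (l + s) → I,
      CokerFinite (fiberMap (headIdeal_le l f)) (fiberMap (fullIdeal_le f)) →
      (∀ᶠ n : ℕ in Filter.atTop, I ^ n = headIdeal l f * I ^ (n - 1) + tailIdeal l f ^ n) :=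
    fun f h => eventually_pow_eq_of_cokerFinite h
  by_cases hU : ∃ w : Fin (l + s) → ResidueField R ⊗[R] I, ∃ n, 1 ≤ n ∧ IsReductionAt I l n w
  -- If some tuple is a reduction, the set of reductions is a nonempty open set on which all three
  -- conditions hold.
  · refine ⟨_, isZariskiOpen_isReductionAt I l (l + s), hU, fun f hf => ?_⟩
    have hQ := h23 _ hf
    tfae_have 2 → 1 := h41 f
    tfae_have 1 → 3 := fun _ => embDim_le_of_quotientFinite hl_pos _ hQ
    tfae_have 3 → 2 := fun _ => h34 f hQ
    tfae_finish
  -- If no tuple is a reduction, the first two conditions fail for every tuple, and so does the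
  -- third, since it would produce such a tuple.
  · refine ⟨Set.univ, isZariskiOpen_univ _ _, Set.univ_nonempty, fun f _ => ?_⟩
    tfae_have 2 → 1 := h41 f
    tfae_have 1 → 3 := fun h => (hU ⟨_, h12 f h⟩).elim
    tfae_have 3 → 2 := fun h => by
      obtain ⟨v, hv⟩ := exists_quotientFinite_of_embDim_le (adjoin_range_fiberLinear I) hl hl_pos
        hs h
      obtain ⟨g, hg⟩ := tupleImage_surjective v
      exact (hU ⟨_, h12 g (h41 g (h34 g (hg ▸ hv)))⟩).elim
    tfae_finish
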